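/- Let $D>1$ and $m\ge 0$. Write $x=(x_0,x_1,x_\perp)\in\mathbb R^{D+1}$ with $x_\perp\in\mathbb R^{D-1}$, let $x_\pm=(x_0\pm x_1)/\sqrt2$, let $x\cdot p=x_0p_0-x_1p_1-\langle x_\perp,p_\perp\rangle=x_+p_-+x_-p_+-\langle x_\perp,p_\perp\rangle$, and let $X_-^0=\{x_-=0\}$ be the null plane, with coordinates $(x_+,x_\perp)\in\mathbb R\times\mathbb R^{D-1}$. *One-particle space.* $\mathfrak H_m=L^2(\Omega_m,d\Omega_m)$, where $\Omega_m=\{(\omega_m(p),p):p\in\mathbb R^D\}$, $\omega_m(p)=\sqrt{m^2+|p|^2}$, $d\Omega_m=d^Dp/\omega_m(p)$. *Spatial decomposition.* Let $V_M:\mathfrak H_m\to L^2(\mathbb R\times\mathbb R^{D-1},d\theta'\,dp_\perp)$ be the unitary such that $(V_M\xi)(\theta',p_\perp)$ is the value of $\xi$ at the point of $\Omega_m$ with $p_-=e^{-\theta'}$ and transversal momentum $p_\perp$. Let $V_S:\mathfrak H_m\to\int^\oplus_{\mathbb R^{D-1}}L^2(\mathbb R,d\theta')\,dx_\perp=L^2(\mathbb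 R^{D-1};L^2(\mathbb R,d\theta'))$ be the unitary obtained from $V_M$ by applying the unitary inverse Fourier transform $f\mapsto(2\pi)^{-(D-1)/2}\int e^{i\langle x_\perp,p_\perp\rangle}f(p_\perp)\,dp_\perp$ in the transversal momenta. *Local subspaces of the null plane.* For $h\in C_c^\infty(X_-^0,\mathbb R)$ put $(E(\delta(x_-)h))(p)=\int e^{i(x_+p_--\langle x_\perp,p_\perp\rangle)}h(x_+,x_\perp)\,dx_+dx_\perp$ for $p\in\Omega_m$. For a bounded open $R\subset X_-^0$, $H(R)\subset\mathfrak H_m$ is the closed real linear span of the vectors $E(\delta(x_-)\,\partial_{x_+}g)$ with $g\in C_c^\infty(X_-^0,\mathbb R)$, $\operatorname{supp}g\subset R$. For a general open $R\subset X_-^0$, $H(R)$ is the closed real linear span of all $H(S)$ with $S\subset R$ open and bounded. *$U(1)$-current subspaces.* For an open interval $I\subset\mathbb R$ (possibly unbounded or empty), $H_{U(1)}(I)\subset L^2(\mathbb R,d\theta')$ is the closure of $\{\theta'\mapsto\hat g(e^{-\theta'}):g\in C_c^\infty(\mathbb R,\mathbb R),\ \operatorname{supp}g\subset I,\ \hat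 g(0)=0\}$, where $\hat g(p)=\int e^{ixp}g(x)\,dx$. *Real direct integrals.* For a measurable $S\subset\mathbb R^{D-1}$ and closed real subspaces $H_{x_\perp}\subset L^2(\mathbb R,d\theta')$, the equality $\mathcal H=\int^{\oplus_{\mathbb R}}_{S}H_{x_\perp}\,dx_\perp$ means that the field $x_\perp\mapsto H_{x_\perp}$ is measurable over $S$ (there is a sequence of measurable vector fields $s_k$ such that $H_{x_\perp}$ is the closed real span of $\{s_k(x_\perp)\}_k$ for almost every $x_\perp\in S$), and that $\mathcal H$ is the set of all $\xi\in L^2(\mathbb R^{D-1};L^2(\mathbb R,d\theta'))$ with $\xi(x_\perp)\in H_{x_\perp}$ for almost every $x_\perp\in S$ and $\xi(x_\perp)=0$ for almost every $x_\perp\notin S$. **Proposition.** (1) Let $I_\perp\subset\mathbb R^{D-1}$ be open, let $C_1,C_2$ be continuous real-valued functions on $I_\perp$, and let $R=\{(x_+,x_\perp)\in X_-^0:x_\perp\in I_\perp,\ C_1(x_\perp)<x_+<C_2(x_\perp)\}$. Then $$V_S\,H(R)=\int^{\oplus_{\mathbb R}}_{I_\perp}H_{U(1)}\big((C_1(x_\perp),C_2(x_\perp))\big)\,dx_\perp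 .$$ (2) Let $C:\mathbb R^{D-1}\to\mathbb R$ be continuous, let $N_C=\{(x_+,x_\perp)\in X_-^0:x_+>C(x_\perp)\}$, and let $N_C^\dagger=X_-^0\setminus\overline{N_C}$ (which is $\{x_+<C(x_\perp)\}$). Then $$V_S\,H(N_C)=\int^{\oplus_{\mathbb R}}_{\mathbb R^{D-1}}H_{U(1)}\big((C(x_\perp),\infty)\big)\,dx_\perp,\qquad V_S\,H(N_C^\dagger)=\int^{\oplus_{\mathbb R}}_{\mathbb R^{D-1}}H_{U(1)}\big((-\infty,C(x_\perp))\big)\,dx_\perp .$$ -/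

import Mathlib

open MeasureTheory Set
open scoped FourierTransform ContDiff

namespace NullPlane

noncomputable section

/-! ### Sections of a product `L²` space: `L²(α × β) ≃ L²(β; L²(α))` -/

section Curry

variable {α β : Type*} [MeasurableSpace α] [MeasurableSpace β]

open Classical in
/-- The section `a ↦ f (a, b)` as an element of `L²(α)` (zero if it is not square integrable). -/
def sectionL2 (μ : Measure α) (f : α × β → ℂ) (b : β) : Lp ℂ 2 μ :=
  if h : MemLp (fun a => f (a, b)) 2 μ then h.toLp _ else 0

variable {μ : Measure α} {ν : Measure β}

lemma lintegral_sections [SFinite μ] [SFinite ν] {f : α × β → ℂ}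
    (hf : AEStronglyMeasurable f (μ.prod ν)) :
    ∫⁻ b, ∫⁻ a, ‖f (a, b)‖ₑ ^ (2 : ℝ) ∂μ ∂ν = ∫⁻ z, ‖f z‖ₑ ^ (2 : ℝ) ∂(μ.prod ν) := by
  have hm : AEMeasurable (fun z => ‖f z‖ₑ ^ (2 : ℝ)) (μ.prod ν) :=
    hf.enorm.pow_const _
  rw [lintegral_prod_symm _ hm]

lemma eLpNorm_two {γ E : Type*} [MeasurableSpace γ] [NormedAddCommGroup E] (κ : Measure γ)
    (f : γ → E) : eLpNorm f 2 κ = (∫⁻ z, ‖f z‖ₑ ^ (2 : ℝ) ∂κ) ^ (1 / 2 : ℝ) := by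
  rw [eLpNorm_eq_lintegral_rpow_enorm_toReal (by norm_num) (by norm_num)]
  simp

lemma lintegral_two_lt_top {γ E : Type*} [MeasurableSpace γ] [NormedAddCommGroup E]
    {κ : Measure γ} {f : γ → E} :
    eLpNorm f 2 κ < ⊤ ↔ ∫⁻ z, ‖f z‖ₑ ^ (2 : ℝ) ∂κ < ⊤ := by
  rw [eLpNorm_lt_top_iff_lintegral_rpow_enorm_lt_top (by norm_num) (by norm_num)]
  simp

lemma ae_memLp_section [SFinite μ] [SFinite ν] {f : α × β → ℂ} (hf : MemLp f 2 (μ.prod ν)) :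
    ∀ᵐ b ∂ν, MemLp (fun a => f (a, b)) 2 μ := by
  have h1 : ∀ᵐ b ∂ν, AEStronglyMeasurable (fun a => f (a, b)) μ :=
    hf.1.prod_swap.prodMk_left
  have hm : AEMeasurable (fun b => ∫⁻ a, ‖f (a, b)‖ₑ ^ (2 : ℝ) ∂μ) ν := by
    have := (hf.1.enorm.pow_const (2 : ℝ)).prod_swap
    exact this.lintegral_prod_right'
  have hlt : ∫⁻ b, ∫⁻ a, ‖f (a, b)‖ₑ ^ (2 : ℝ) ∂μ ∂ν < ⊤ := by
    rw [lintegral_sections hf.1]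
    exact lintegral_two_lt_top.1 hf.2
  filter_upwards [h1, ae_lt_top' hm hlt.ne] with b hb hb'
  exact ⟨hb, lintegral_two_lt_top.2 hb'⟩

lemma measurable_of_edist {γ E : Type*} [MeasurableSpace γ] [PseudoEMetricSpace E]
    [MeasurableSpace E] [BorelSpace E] [SecondCountableTopology E] {F : γ → E}
    (h : ∀ y, Measurable fun b => edist (F b) y) : Measurable F := by
  refine measurable_of_isClosed fun C hC => ?_
  obtain ⟨S, hSC, hSc, hS⟩ := TopologicalSpace.IsSeparable.exists_countable_dense_subset
    (TopologicalSpace.IsSeparable.of_separableSpace C)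
  have hcl : closure S = C := subset_antisymm (closure_minimal hSC hC) hS
  have : F ⁻¹' C = (fun b => ⨅ y ∈ S, edist (F b) y) ⁻¹' {0} := by
    ext b
    rw [mem_preimage, ← hcl, Metric.mem_closure_iff_infEDist_zero]
    rfl
  rw [this]
  exact (Measurable.biInf S hSc fun y _ => h y) (measurableSet_singleton 0)

lemma stronglyMeasurable_sectionL2 [SFinite μ] [MeasurableSpace.CountablyGenerated α]
    {f : α × β → ℂ} (hf : StronglyMeasurable f) :
    StronglyMeasurable (sectionL2 μ f) := by
  let _ : MeasurableSpace (Lp ℂ 2 μ) := borel _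
  have : BorelSpace (Lp ℂ 2 μ) := ⟨rfl⟩
  have : Fact ((2 : ENNReal) ≠ ⊤) := ⟨by norm_num⟩
  refine Measurable.stronglyMeasurable (measurable_of_edist fun y => ?_)
  have hsec : ∀ b, StronglyMeasurable fun a => f (a, b) := fun b =>
    hf.comp_measurable measurable_prodMk_right
  have hmem : ∀ b, MemLp (fun a => f (a, b)) 2 μ ↔ ∫⁻ a, ‖f (a, b)‖ₑ ^ (2 : ℝ) ∂μ < ⊤ :=
    fun b => ⟨fun h => lintegral_two_lt_top.1 h.2,
      fun h => ⟨(hsec b).aestronglyMeasurable, lintegral_two_lt_top.2 h⟩⟩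
  have hm1 : Measurable fun b => ∫⁻ a, ‖f (a, b)‖ₑ ^ (2 : ℝ) ∂μ :=
    Measurable.lintegral_prod_left' (f := fun z => ‖f z‖ₑ ^ (2 : ℝ))
      (hf.measurable.enorm.pow_const _)
  have hy : Measurable y := (Lp.stronglyMeasurable y).measurable
  have hm2 : Measurable fun b => ∫⁻ a, ‖f (a, b) - y a‖ₑ ^ (2 : ℝ) ∂μ :=
    Measurable.lintegral_prod_left' (f := fun z : α × β => ‖f z - y z.1‖ₑ ^ (2 : ℝ))
      ((hf.measurable.sub (hy.comp measurable_fst)).enorm.pow_const _)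
  classical
  have key : (fun b => edist (sectionL2 μ f b) y) = fun b =>
      if ∫⁻ a, ‖f (a, b)‖ₑ ^ (2 : ℝ) ∂μ < ⊤ then
        (∫⁻ a, ‖f (a, b) - y a‖ₑ ^ (2 : ℝ) ∂μ) ^ (1 / 2 : ℝ) else edist 0 y := by
    funext b
    by_cases h : MemLp (fun a => f (a, b)) 2 μ
    · rw [if_pos ((hmem b).1 h), sectionL2, dif_pos h, Lp.edist_def, ← eLpNorm_two]
      refine eLpNorm_congr_ae ?_
      filter_upwards [h.coeFn_toLp] with a ha
      simp [ha]
    · rw [if_neg (fun h' => h ((hmem b).2 h')), sectionL2, dif_neg h]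
  rw [key]
  exact Measurable.ite (measurableSet_lt hm1 measurable_const) (hm2.pow_const _) measurable_const

lemma sectionL2_congr [SFinite μ] [SFinite ν] {f g : α × β → ℂ} (h : f =ᵐ[μ.prod ν] g) :
    sectionL2 μ f =ᵐ[ν] sectionL2 μ g := by
  have h' : ∀ᵐ b ∂ν, ∀ᵐ a ∂μ, f (a, b) = g (a, b) :=
    Measure.ae_ae_of_ae_prod (Measure.measurePreserving_swap.quasiMeasurePreserving.ae h)
  filter_upwards [h'] with b hb
  have hiff : MemLp (fun a => f (a, b)) 2 μ ↔ MemLp (fun a => g (a, b)) 2 μ := memLp_congr_ae hb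
  by_cases hf : MemLp (fun a => f (a, b)) 2 μ
  · rw [sectionL2, sectionL2, dif_pos hf, dif_pos (hiff.1 hf)]
    exact (MemLp.toLp_eq_toLp_iff _ _).2 hb
  · rw [sectionL2, sectionL2, dif_neg hf, dif_neg (fun h => hf (hiff.2 h))]

lemma eLpNorm_sectionL2 [SFinite μ] [SFinite ν] {f : α × β → ℂ} (hf : MemLp f 2 (μ.prod ν)) :
    eLpNorm (sectionL2 μ f) 2 ν = eLpNorm f 2 (μ.prod ν) := by
  rw [eLpNorm_two, eLpNorm_two, ← lintegral_sections hf.1]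
  congr 1
  refine lintegral_congr_ae ?_
  filter_upwards [ae_memLp_section hf] with b hb
  have : ‖sectionL2 μ f b‖ₑ = eLpNorm (fun a => f (a, b)) 2 μ := by
    rw [sectionL2, dif_pos hb, Lp.enorm_toLp]
  rw [this, eLpNorm_two, ← ENNReal.rpow_mul]
  norm_num

lemma memLp_sectionL2 [SFinite μ] [SFinite ν] [MeasurableSpace.CountablyGenerated α]
    (f : Lp ℂ 2 (μ.prod ν)) : MemLp (sectionL2 μ f) 2 ν :=
  ⟨(stronglyMeasurable_sectionL2 (Lp.stronglyMeasurable f)).aestronglyMeasurable,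
    by rw [eLpNorm_sectionL2 (Lp.memLp f)]; exact (Lp.memLp f).2⟩

/-- The isometry `L²(α × β) → L²(β; L²(α))`, `f ↦ (b ↦ f (·, b))`. -/
def curryIsometry (μ : Measure α) (ν : Measure β) [SFinite μ] [SFinite ν]
    [MeasurableSpace.CountablyGenerated α] :
    Lp ℂ 2 (μ.prod ν) →ₗᵢ[ℂ] Lp (Lp ℂ 2 μ) 2 ν where
  toFun f := (memLp_sectionL2 f).toLp _
  map_add' f g := by
    refine (((memLp_sectionL2 _).toLp_eq_toLp_iff
      ((memLp_sectionL2 f).add (memLp_sectionL2 g))).2 ?_).trans (MemLp.toLp_add _ _)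
    have h' := sectionL2_congr (μ := μ) (ν := ν) (Lp.coeFn_add f g)
    filter_upwards [h', ae_memLp_section (Lp.memLp f), ae_memLp_section (Lp.memLp g)]
      with b hb hf hg
    rw [hb, Pi.add_apply, sectionL2, sectionL2, sectionL2, dif_pos hf, dif_pos hg]
    exact (dif_pos (hf.add hg)).trans (MemLp.toLp_add hf hg)
  map_smul' c f := by
    refine (((memLp_sectionL2 _).toLp_eq_toLp_iff
      ((memLp_sectionL2 f).const_smul c)).2 ?_).trans (MemLp.toLp_const_smul _ _)
    have h' := sectionL2_congr (μ := μ) (ν := ν) (Lp.coeFn_smul c f)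
    filter_upwards [h', ae_memLp_section (Lp.memLp f)] with b hb hf
    rw [hb, Pi.smul_apply, sectionL2, sectionL2, dif_pos hf]
    exact (dif_pos (hf.const_smul c)).trans (MemLp.toLp_const_smul c hf)
  norm_map' f := by
    change ‖(memLp_sectionL2 f).toLp _‖ = ‖f‖
    rw [Lp.norm_toLp, eLpNorm_sectionL2 (Lp.memLp f), Lp.norm_def]

lemma curryIsometry_surjective (μ : Measure α) (ν : Measure β) [SFinite μ] [SFinite ν]
    [MeasurableSpace.CountablyGenerated α] :
    Function.Surjective (curryIsometry μ ν) := by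
  intro F
  refine Lp.induction (p := 2) (by norm_num) (fun F => F ∈ Set.range (curryIsometry μ ν))
    ?_ ?_ ?_ F
  · intro c s hs hμs
    set u : α × β → ℂ := fun z => s.indicator (fun _ => c z.1) z.2 with hu_def
    have hum : AEStronglyMeasurable u (μ.prod ν) := by
      have : u = (Prod.snd ⁻¹' s).indicator (fun z => c z.1) := by
        funext z; by_cases hz : z.2 ∈ s <;> simp [hu_def, hz]
      rw [this]
      exact (((Lp.stronglyMeasurable c).comp_measurable measurable_fst).indicator
        (measurable_snd hs)).aestronglyMeasurable
    have hu : MemLp u 2 (μ.prod ν) := by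
      refine ⟨hum, lintegral_two_lt_top.2 ?_⟩
      rw [← lintegral_sections hum]
      have : (fun b => ∫⁻ a, ‖u (a, b)‖ₑ ^ (2 : ℝ) ∂μ)
          = s.indicator fun _ => ∫⁻ a, ‖c a‖ₑ ^ (2 : ℝ) ∂μ := by
        funext b; by_cases hb : b ∈ s <;> simp [hu_def, hb]
      rw [this, lintegral_indicator_const hs]
      exact ENNReal.mul_lt_top (lintegral_two_lt_top.1 (Lp.memLp c).2) hμs
    refine ⟨hu.toLp u, ?_⟩
    rw [Lp.simpleFunc.coe_indicatorConst]
    refine (MemLp.toLp_eq_toLp_iff (memLp_sectionL2 (hu.toLp u)) _).2 ?_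
    filter_upwards [sectionL2_congr (μ := μ) (ν := ν) hu.coeFn_toLp] with b hb
    rw [hb]
    by_cases hbs : b ∈ s
    · have h1 : (fun a => u (a, b)) = c := by funext a; simp [hu_def, hbs]
      have h2 : MemLp (fun a => u (a, b)) 2 μ := by rw [h1]; exact Lp.memLp c
      rw [sectionL2, dif_pos h2, indicator_of_mem hbs]
      exact Lp.ext (h2.coeFn_toLp.trans (Filter.EventuallyEq.of_eq h1))
    · have h1 : (fun a => u (a, b)) = 0 := by funext a; simp [hu_def, hbs]
      have h2 : MemLp (fun a => u (a, b)) 2 μ := by rw [h1]; exact MemLp.zero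
      rw [sectionL2, dif_pos h2, indicator_of_notMem hbs]
      exact Lp.ext ((h2.coeFn_toLp.trans (Filter.EventuallyEq.of_eq h1)).trans
        (Lp.coeFn_zero ℂ 2 μ).symm)
  · rintro f g hf hg - ⟨a, ha⟩ ⟨b, hb⟩
    exact ⟨a + b, by rw [map_add, ha, hb]⟩
  · exact (curryIsometry μ ν).isometry.isClosedEmbedding.isClosed_range

/-- The unitary `L²(α × β) ≃ L²(β; L²(α))`, `f ↦ (b ↦ f (·, b))`. -/
def curryL2 (μ : Measure α) (ν : Measure β) [SFinite μ] [SFinite ν]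
    [MeasurableSpace.CountablyGenerated α] :
    Lp ℂ 2 (μ.prod ν) ≃ₗᵢ[ℂ] Lp (Lp ℂ 2 μ) 2 ν :=
  LinearIsometryEquiv.ofSurjective (curryIsometry μ ν) (curryIsometry_surjective μ ν)

end Curry

/-! ### Dilations -/
section Dilation

variable {V F : Type*} [NormedAddCommGroup V] [InnerProductSpace ℝ V] [FiniteDimensional ℝ V]
  [MeasurableSpace V] [BorelSpace V] [NormedAddCommGroup F]

lemma measurePreserving_dilation {c : ℝ} (hc : 0 < c) :
    MeasurePreserving (fun x : V => c • x) volume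
      (ENNReal.ofReal ((c ^ Module.finrank ℝ V)⁻¹) • volume) :=
  ⟨measurable_const_smul c, by
    rw [Measure.map_addHaar_smul _ hc.ne', abs_of_pos (by positivity)]⟩

lemma ae_dilation {c : ℝ} (hc : 0 < c) {p : V → Prop} (h : ∀ᵐ x ∂(volume : Measure V), p x) :
    ∀ᵐ x ∂(volume : Measure V), p (c • x) :=
  (Measure.quasiMeasurePreserving_smul volume hc.ne').ae h

lemma memLp_dilation {c : ℝ} (hc : 0 < c) {f : V → F} (hf : MemLp f 2 volume) :
    MemLp (fun x : V => f (c • x)) 2 volume :=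
  (hf.smul_measure ENNReal.ofReal_ne_top).comp_measurePreserving (measurePreserving_dilation hc)

lemma eLpNorm_dilation {c : ℝ} (hc : 0 < c) {f : V → F} (hf : MemLp f 2 volume) :
    (eLpNorm (fun x : V => f (c • x)) 2 volume).toReal
      = (Real.sqrt (c ^ Module.finrank ℝ V))⁻¹ * (eLpNorm f 2 volume).toReal := by
  have := eLpNorm_comp_measurePreserving (p := 2)
    (hf.smul_measure (c := ENNReal.ofReal ((c ^ Module.finrank ℝ V)⁻¹))
    ENNReal.ofReal_ne_top).1 (measurePreserving_dilation (V := V) hc)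
  rw [show (fun x : V => f (c • x)) = f ∘ (fun x : V => c • x) from rfl, this,
    eLpNorm_smul_measure_of_ne_top (by norm_num), smul_eq_mul, ENNReal.toReal_mul,
    ← ENNReal.toReal_rpow, ENNReal.toReal_ofReal (by positivity)]
  congr 1
  rw [← Real.sqrt_inv, Real.sqrt_eq_rpow]
  norm_num

/-- The unitary dilation `(δ_c f)(x) = c ^ (dim V / 2) f (c x)` of `L²(V; F)`. -/
def dilationIsometry (V F : Type*) [NormedAddCommGroup V] [InnerProductSpace ℝ V]
    [FiniteDimensional ℝ V] [MeasurableSpace V] [BorelSpace V] [NormedAddCommGroup F]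
    [NormedSpace ℂ F] {c : ℝ} (hc : 0 < c) :
    Lp F 2 (volume : Measure V) →ₗᵢ[ℂ] Lp F 2 (volume : Measure V) where
  toFun f := (Real.sqrt (c ^ Module.finrank ℝ V) : ℂ) • (memLp_dilation hc (Lp.memLp f)).toLp _
  map_add' f g := by
    rw [← smul_add, ← MemLp.toLp_add]
    congr 1
    exact (MemLp.toLp_eq_toLp_iff (memLp_dilation hc (Lp.memLp (f + g)))
      ((memLp_dilation hc (Lp.memLp f)).add (memLp_dilation hc (Lp.memLp g)))).2
      (ae_dilation hc (Lp.coeFn_add f g))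
  map_smul' k f := by
    rw [RingHom.id_apply, smul_comm k]
    refine congrArg (fun g : Lp F 2 (volume : Measure V) =>
      (Real.sqrt (c ^ Module.finrank ℝ V) : ℂ) • g)
      (Eq.trans ?_ (MemLp.toLp_const_smul k (memLp_dilation hc (Lp.memLp f))))
    exact (MemLp.toLp_eq_toLp_iff (memLp_dilation hc (Lp.memLp (k • f)))
      ((memLp_dilation hc (Lp.memLp f)).const_smul k)).2
      (ae_dilation hc (Lp.coeFn_smul k f))
  norm_map' f := by
    change ‖(Real.sqrt (c ^ Module.finrank ℝ V) : ℂ) •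
      (memLp_dilation hc (Lp.memLp f)).toLp _‖ = ‖f‖
    rw [norm_smul, Lp.norm_toLp, eLpNorm_dilation hc (Lp.memLp f), Lp.norm_def, ← mul_assoc]
    have : 0 < Real.sqrt (c ^ Module.finrank ℝ V) := by positivity
    rw [Complex.norm_real, Real.norm_of_nonneg this.le, mul_inv_cancel₀ this.ne', one_mul]

lemma dilationIsometry_surjective (V F : Type*) [NormedAddCommGroup V] [InnerProductSpace ℝ V]
    [FiniteDimensional ℝ V] [MeasurableSpace V] [BorelSpace V] [NormedAddCommGroup F]
    [NormedSpace ℂ F] {c : ℝ} (hc : 0 < c) :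
    Function.Surjective (dilationIsometry V F hc) := by
  intro f
  have hk : (Real.sqrt (c ^ Module.finrank ℝ V) : ℂ) ≠ 0 := by
    have : 0 < Real.sqrt (c ^ Module.finrank ℝ V) := by positivity
    exact_mod_cast this.ne'
  have hm := memLp_dilation (V := V) (inv_pos.2 hc) (Lp.memLp f)
  refine ⟨(Real.sqrt (c ^ Module.finrank ℝ V) : ℂ)⁻¹ • hm.toLp _, ?_⟩
  rw [map_smul, inv_smul_eq_iff₀ hk]
  refine congrArg (fun g : Lp F 2 (volume : Measure V) =>
    (Real.sqrt (c ^ Module.finrank ℝ V) : ℂ) • g) ?_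
  refine Lp.ext ((memLp_dilation hc (Lp.memLp (hm.toLp _))).coeFn_toLp.trans ?_)
  filter_upwards [ae_dilation hc hm.coeFn_toLp] with x hx
  rw [hx, inv_smul_smul₀ hc.ne']

/-- The unitary dilation `(δ_c f)(x) = c ^ (dim V / 2) f (c x)` of `L²(V; F)`. -/
def dilationL2 (V F : Type*) [NormedAddCommGroup V] [InnerProductSpace ℝ V]
    [FiniteDimensional ℝ V] [MeasurableSpace V] [BorelSpace V] [NormedAddCommGroup F]
    [NormedSpace ℂ F] {c : ℝ} (hc : 0 < c) :
    Lp F 2 (volume : Measure V) ≃ₗᵢ[ℂ] Lp F 2 (volume : Measure V) :=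
  LinearIsometryEquiv.ofSurjective (dilationIsometry V F hc) (dilationIsometry_surjective V F hc)

/-- The unitary inverse Fourier transform of `L²(V; F)`, in the normalisation
`f ↦ (x ↦ (2π) ^ (- dim V / 2) ∫ exp(i ⟨x, p⟩) f(p) dp)`. -/
def inverseFourierL2 (V F : Type*) [NormedAddCommGroup V] [InnerProductSpace ℝ V]
    [FiniteDimensional ℝ V] [MeasurableSpace V] [BorelSpace V] [NormedAddCommGroup F]
    [InnerProductSpace ℂ F] [CompleteSpace F] :
    Lp F 2 (volume : Measure V) ≃ₗᵢ[ℂ] Lp F 2 (volume : Measure V) :=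
  (Lp.fourierTransformₗᵢ V F).symm.trans
    (dilationL2 V F (c := (2 * Real.pi)⁻¹) (inv_pos.2 Real.two_pi_pos))

end Dilation

/-! ### Minkowski space, the mass shell and the one-particle space -/

section Field

/-- The transversal space `ℝ^(D-1)`. -/
abbrev Perp (D : ℕ) : Type := EuclideanSpace ℝ (Fin (D - 1))

/-- Minkowski space `ℝ^(D+1)` with coordinates `(x₀, x₁, x_⊥)`. -/
abbrev Mink (D : ℕ) : Type := ℝ × ℝ × Perp D

/-- The null plane `x₋ = 0` with coordinates `(x₊, x_⊥)`. -/
abbrev NPlane (D : ℕ) : Type := ℝ × Perp D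

/-- The Minkowski product `x · p = x₀ p₀ - x₁ p₁ - ⟨x_⊥, p_⊥⟩`. -/
def minkProd {D : ℕ} (x p : Mink D) : ℝ :=
  x.1 * p.1 - x.2.1 * p.2.1 - inner ℝ x.2.2 p.2.2

/-- The point of Minkowski space with lightlike coordinates `x₊ = (x₀ + x₁)/√2`,
`x₋ = (x₀ - x₁)/√2` and transversal coordinate `x_⊥`. -/
def lightPoint {D : ℕ} (xplus xminus : ℝ) (xperp : Perp D) : Mink D :=
  ((xplus + xminus) / √2, (xplus - xminus) / √2, xperp)

/-- The energy `ω_m(p) = √(m² + |p|²)`, `p = (p₁, p_⊥) ∈ ℝ^D`. -/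
def energy {D : ℕ} (m : ℝ) (p : ℝ × Perp D) : ℝ := √(m ^ 2 + (p.1 ^ 2 + ‖p.2‖ ^ 2))

/-- The Lorentz invariant measure `d^D p / ω_m(p)` of the mass shell
`{(ω_m(p), p) : p ∈ ℝ^D}`, as a measure on momentum space. -/
def massShellMeasure (D : ℕ) (m : ℝ) : Measure (Mink D) :=
  ((volume : Measure (ℝ × Perp D)).withDensity fun p => ENNReal.ofReal (1 / energy m p)).map
    fun p => (energy m p, p)

/-- The one-particle space of mass `m`. -/
abbrev OneParticle (D : ℕ) (m : ℝ) : Type := Lp ℂ 2 (massShellMeasure D m)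

/-- The point of the mass shell with `p₋ = exp (-θ')` and transversal momentum `p_⊥`; its other
lightlike coordinate is `p₊ = (m² + |p_⊥|²) / (2 p₋)`. -/
def shellPoint {D : ℕ} (m : ℝ) (z : ℝ × Perp D) : Mink D :=
  lightPoint ((m ^ 2 + ‖z.2‖ ^ 2) / (2 * Real.exp (-z.1))) (Real.exp (-z.1)) z.2

/-- The coordinates `(θ', p_⊥)` of a momentum, `θ' = - log p₋ = - log ((p₀ - p₁)/√2)`. -/
def shellCoord {D : ℕ} (p : Mink D) : ℝ × Perp D :=
  (-Real.log ((p.1 - p.2.1) / √2), p.2.2)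

lemma shellCoord_shellPoint {D : ℕ} (m : ℝ) (z : ℝ × Perp D) :
    shellCoord (shellPoint m z) = z := by
  have h2 : (√2 : ℝ) * √2 = 2 := Real.mul_self_sqrt (by norm_num)
  have : ∀ a b : ℝ, ((a + b) / √2 - (a - b) / √2) / √2 = b := by
    intro a b
    rw [← sub_div, div_div, h2]; ring
  refine Prod.ext ?_ rfl
  simp only [shellCoord, shellPoint, lightPoint]
  rw [this, Real.log_exp, neg_neg]

lemma measurable_shellPoint {D : ℕ} (m : ℝ) : Measurable (shellPoint (D := D) m) := by
  unfold shellPoint lightPoint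
  fun_prop

lemma measurable_energy {D : ℕ} (m : ℝ) : Measurable (energy (D := D) m) := by
  unfold energy
  fun_prop

/-- The momentum `p₁` as a function of `θ'`, with `k = m² + |p_⊥|²`. -/
def pOne (k t : ℝ) : ℝ := (k / (2 * Real.exp (-t)) - Real.exp (-t)) / √2

lemma pOne_sq {k : ℝ} (hk : 0 < k) (t : ℝ) :
    √(k + pOne k t ^ 2) = (k / (2 * Real.exp (-t)) + Real.exp (-t)) / √2 := by
  have h2 : (√2 : ℝ) ^ 2 = 2 := Real.sq_sqrt (by norm_num)
  have he := Real.exp_pos (-t)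
  rw [← Real.sqrt_sq (show 0 ≤ (k / (2 * Real.exp (-t)) + Real.exp (-t)) / √2 by positivity)]
  congr 1
  rw [pOne, div_pow, div_pow, h2]
  field_simp
  ring

lemma hasDerivAt_pOne (k t : ℝ) :
    HasDerivAt (pOne k) ((k / (2 * Real.exp (-t)) + Real.exp (-t)) / √2) t := by
  have h1 : pOne k = fun t => (k / 2 * Real.exp t - Real.exp (-t)) / √2 := by
    funext t; rw [pOne, Real.exp_neg]; field_simp
  have h2 : HasDerivAt (fun t : ℝ => Real.exp (-t)) (-Real.exp (-t)) t := by
    simpa using (hasDerivAt_neg t).exp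
  rw [h1]
  refine ((((Real.hasDerivAt_exp t).const_mul (k / 2)).sub h2).div_const (√2)).congr_deriv ?_
  rw [Real.exp_neg]; field_simp; ring

lemma lintegral_pOne {k : ℝ} (hk : 0 < k) (f : ℝ → ENNReal) :
    ∫⁻ t, f (pOne k t) = ∫⁻ q, ENNReal.ofReal (1 / √(k + q ^ 2)) * f q := by
  have hpos : ∀ t, 0 < (k / (2 * Real.exp (-t)) + Real.exp (-t)) / √2 := fun t => by
    have := Real.exp_pos (-t); positivity
  have hmono : StrictMono (pOne k) :=
    strictMono_of_deriv_pos fun t => by rw [(hasDerivAt_pOne k t).deriv]; exact hpos t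
  have hcont : Continuous (pOne k) :=
    continuous_iff_continuousAt.2 fun t => (hasDerivAt_pOne k t).continuousAt
  have hsurj : Function.Surjective (pOne k) := by
    have h1 : pOne k = fun t => (k / 2 * Real.exp t + -Real.exp (-t)) / √2 := by
      funext t; rw [pOne, Real.exp_neg]; field_simp; ring
    refine hcont.surjective ?_ ?_
    · rw [h1]
      refine Filter.Tendsto.atTop_div_const (by positivity) ?_
      refine Filter.Tendsto.atTop_add (Real.tendsto_exp_atTop.const_mul_atTop (by positivity))
        (C := 0) ?_
      simpa using (Real.tendsto_exp_atBot.comp Filter.tendsto_neg_atTop_atBot).neg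
    · rw [h1]
      refine Filter.Tendsto.atBot_div_const (by positivity) ?_
      refine Filter.Tendsto.add_atBot (C := 0) ?_ ?_
      · simpa using Real.tendsto_exp_atBot.const_mul (k / 2)
      · exact Filter.tendsto_neg_atTop_atBot.comp
          (Real.tendsto_exp_atTop.comp Filter.tendsto_neg_atBot_atTop)
  have h := lintegral_image_eq_lintegral_abs_deriv_mul (s := univ) MeasurableSet.univ
    (fun t _ => (hasDerivAt_pOne k t).hasDerivWithinAt) hmono.injective.injOn
    (fun q => ENNReal.ofReal (1 / √(k + q ^ 2)) * f q)
  rw [image_univ, hsurj.range_eq, setLIntegral_univ, setLIntegral_univ] at h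
  rw [h]
  refine lintegral_congr fun t => ?_
  rw [pOne_sq hk, abs_of_pos (hpos t), ← mul_assoc, ← ENNReal.ofReal_mul (hpos t).le,
    mul_one_div_cancel (hpos t).ne', ENNReal.ofReal_one, one_mul]

lemma shellPoint_eq {D : ℕ} (m : ℝ) {z : ℝ × Perp D} (hk : 0 < m ^ 2 + ‖z.2‖ ^ 2) :
    shellPoint m z =
      (energy m (pOne (m ^ 2 + ‖z.2‖ ^ 2) z.1, z.2), pOne (m ^ 2 + ‖z.2‖ ^ 2) z.1, z.2) := by
  refine Prod.ext ?_ rfl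
  have := pOne_sq hk z.1
  simp only [shellPoint, lightPoint, energy]
  rw [← this]
  congr 1
  ring

lemma measurePreserving_shellPoint {D : ℕ} (hD : 1 < D) (m : ℝ) :
    MeasurePreserving (shellPoint m) (volume : Measure (ℝ × Perp D)) (massShellMeasure D m) := by
  refine ⟨measurable_shellPoint m, ?_⟩
  have hE := measurable_energy (D := D) m
  have hne : Nonempty (Fin (D - 1)) := ⟨⟨0, by omega⟩⟩
  refine Measure.ext_of_lintegral _ fun f hf => ?_
  have hι : Measurable fun p : ℝ × Perp D => ((energy m p, p) : Mink D) := hE.prodMk measurable_id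
  have hw : Measurable fun p : ℝ × Perp D => ENNReal.ofReal (1 / energy m p) :=
    (hE.const_div 1).ennreal_ofReal
  have hg : Measurable fun p : ℝ × Perp D => f (energy m p, p) := hf.comp hι
  rw [lintegral_map hf (measurable_shellPoint m), massShellMeasure, lintegral_map hf hι,
    lintegral_withDensity_eq_lintegral_mul _ hw hg, Measure.volume_eq_prod,
    lintegral_prod_symm (fun z => f (shellPoint m z))
      (hf.comp (measurable_shellPoint m)).aemeasurable,
    lintegral_prod_symm _ (hw.mul hg).aemeasurable]
  refine lintegral_congr_ae ?_
  have h0 : ∀ᵐ p : Perp D, p ≠ 0 := by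
    simp [ae_iff]
  filter_upwards [h0] with p hp
  have hk : 0 < m ^ 2 + ‖p‖ ^ 2 := by positivity
  have h1 : ∀ t, shellPoint m (t, p) = (energy m (pOne (m ^ 2 + ‖p‖ ^ 2) t, p),
      pOne (m ^ 2 + ‖p‖ ^ 2) t, p) := fun t => shellPoint_eq m (z := (t, p)) hk
  simp only [h1]
  rw [lintegral_pOne hk fun q => f (energy m (q, p), q, p)]
  refine lintegral_congr fun q => ?_
  simp only [Pi.mul_apply, energy]
  rw [show m ^ 2 + ‖p‖ ^ 2 + q ^ 2 = m ^ 2 + (q ^ 2 + ‖p‖ ^ 2) by ring]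

/-- The momentum decomposition `V_M : 𝔥_m → L²(ℝ^D, dθ' dp_⊥)`,
`(V_M ξ)(θ', p_⊥) = ξ(p)` at the point `p` of the mass shell with `p₋ = exp (-θ')` and transversal
momentum `p_⊥`. -/
def momentumDecomposition {D : ℕ} (hD : 1 < D) (m : ℝ) :
    OneParticle D m ≃ₗᵢ[ℂ] Lp ℂ 2 (volume : Measure (ℝ × Perp D)) :=
  LinearIsometryEquiv.ofSurjective
    (Lp.compMeasurePreservingₗᵢ ℂ (shellPoint m) (measurePreserving_shellPoint hD m)) (by
      intro f
      have hφ := measurePreserving_shellPoint hD m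
      have hψm : Measurable (shellCoord (D := D)) := by
        unfold shellCoord
        fun_prop
      have hψ : MeasurePreserving (shellCoord (D := D)) (massShellMeasure D m) volume := by
        refine ⟨hψm, ?_⟩
        rw [← hφ.map_eq, Measure.map_map hψm hφ.measurable]
        have : shellCoord ∘ shellPoint (D := D) m = id := funext (shellCoord_shellPoint m)
        rw [this, Measure.map_id]
      refine ⟨Lp.compMeasurePreserving shellCoord hψ f, Lp.ext ?_⟩
      refine (Lp.coeFn_compMeasurePreserving _ hφ).trans ?_
      filter_upwards [hφ.quasiMeasurePreserving.ae (Lp.coeFn_compMeasurePreserving f hψ)]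
        with z hz
      rw [Function.comp_apply, hz, Function.comp_apply, shellCoord_shellPoint])

/-- The `U(1)`-current one-particle space `L²(ℝ, dθ')`. -/
abbrev HU1 : Type := Lp ℂ 2 (volume : Measure ℝ)

/-- The spatial decomposition
`V_S : 𝔥_m → ∫^⊕ L²(ℝ, dθ') dx_⊥ = L²(ℝ^(D-1), dx_⊥; L²(ℝ, dθ'))`: the momentum decomposition
followed by the inverse Fourier transform in the transversal momenta. -/
def spatialDecomposition {D : ℕ} (hD : 1 < D) (m : ℝ) :
    OneParticle D m ≃ₗᵢ[ℂ] Lp HU1 2 (volume : Measure (Perp D)) :=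
  ((momentumDecomposition hD m).trans
    (curryL2 (volume : Measure ℝ) (volume : Measure (Perp D)))).trans
    (inverseFourierL2 (Perp D) HU1)

/-! ### Local subspaces of the null plane -/

/-- The Fourier transform `(E g₀)(p) = ∫ exp(i x · p) g₀(x) dx` of the thin test function
`g₀(x) = δ(x₋) g(x₊, x_⊥)`. -/
def thinFourier {D : ℕ} (g : NPlane D → ℝ) (p : Mink D) : ℂ :=
  ∫ y : NPlane D, Complex.exp (Complex.I * (minkProd (lightPoint y.1 0 y.2) p : ℝ)) * (g y : ℂ)

/-- The partial derivative `∂g/∂x₊`. -/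
def derivPlus {D : ℕ} (g : NPlane D → ℝ) (y : NPlane D) : ℝ :=
  deriv (fun t => g (t, y.2)) y.1

/-- `H(R)` for a bounded open region `R` of the null plane: the closed real linear span of the
vectors `E g₀ ∈ 𝔥_m`, `g₀ = δ(x₋) ∂₊g`, `g` real-valued, smooth, compactly supported in `R`. -/
def boundedLocalSubspace {D : ℕ} (m : ℝ) (R : Set (NPlane D)) :
    Submodule ℝ (OneParticle D m) :=
  (Submodule.span ℝ {ξ : OneParticle D m | ∃ g : NPlane D → ℝ, ContDiff ℝ ∞ g ∧
    HasCompactSupport g ∧ tsupport g ⊆ R ∧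
    ξ =ᵐ[massShellMeasure D m] thinFourier (derivPlus g)}).topologicalClosure

/-- `H(R)` for an open region `R` of the null plane: the closed real linear span of the subspaces
of the bounded open regions contained in `R`. -/
def localSubspace {D : ℕ} (m : ℝ) (R : Set (NPlane D)) : Submodule ℝ (OneParticle D m) :=
  (⨆ S ∈ {S : Set (NPlane D) | IsOpen S ∧ Bornology.IsBounded S ∧ S ⊆ R},
    boundedLocalSubspace m S).topologicalClosure

/-- The null cut `N_C = {x₊ > C(x_⊥)}`. -/
def nullCut {D : ℕ} (C : Perp D → ℝ) : Set (NPlane D) := {y | C y.2 < y.1}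

/-- The interior `N_C^†` of the complement of the null cut `N_C` in the null plane. -/
def nullCutDagger {D : ℕ} (C : Perp D → ℝ) : Set (NPlane D) := (closure (nullCut C))ᶜ

/-- The Fourier transform `ĝ(p) = ∫ exp(i x p) g(x) dx`. -/
def fourierLine (g : ℝ → ℝ) (p : ℝ) : ℂ :=
  ∫ x : ℝ, Complex.exp (Complex.I * ((x * p : ℝ) : ℂ)) * (g x : ℂ)

/-- The subspace `H_{U(1)}(I)` of the `U(1)`-current: the closed real linear span of the functions
`θ' ↦ ĝ(exp (-θ'))`, `g` real-valued, smooth, compactly supported in `I`, `ĝ(0) = 0`. -/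
def currentSubspace (I : Set ℝ) : Submodule ℝ HU1 :=
  (Submodule.span ℝ {ξ : HU1 | ∃ g : ℝ → ℝ, ContDiff ℝ ∞ g ∧ HasCompactSupport g ∧
    tsupport g ⊆ I ∧ fourierLine g 0 = 0 ∧
    ξ =ᵐ[volume] fun θ => fourierLine g (Real.exp (-θ))}).topologicalClosure

end Field

/-! ### Real direct integrals of closed subspaces of a constant field -/

section DirectIntegral

variable {X K : Type*} [MeasurableSpace X] [NormedAddCommGroup K] [NormedSpace ℝ K]

/-- A field `x ↦ H x` of closed real subspaces of `K` is measurable over `S`: there is a sequence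
of measurable vector fields whose values at `x` span a dense subspace of `H x`, for almost every
`x ∈ S`. -/
def IsMeasurableField (ν : Measure X) (S : Set X) (H : X → Submodule ℝ K) : Prop :=
  ∃ s : ℕ → X → K, (∀ k, AEStronglyMeasurable (s k) (ν.restrict S)) ∧
    ∀ᵐ x ∂ν.restrict S, H x = (Submodule.span ℝ (range fun k => s k x)).topologicalClosure

/-- The square integrable sections over `S` of the field `x ↦ H x`, as a subset of
`L²(X, ν; K) = ∫^⊕ K dν`; a section over `S` is extended by zero. -/
def squareIntegrableSections (ν : Measure X) (S : Set X) (H : X → Submodule ℝ K) :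
    Set (Lp K 2 ν) :=
  {ξ | (∀ᵐ x ∂ν, x ∈ S → ξ x ∈ H x) ∧ ∀ᵐ x ∂ν, x ∉ S → ξ x = 0}

/-- `𝓗 = ∫_S^{⊕_ℝ} H x dν(x)`: the field `H` is measurable over `S` and `𝓗` consists of its square
integrable sections. -/
def IsRealDirectIntegral (ν : Measure X) (S : Set X) (H : X → Submodule ℝ K)
    (𝓗 : Set (Lp K 2 ν)) : Prop :=
  IsMeasurableField ν S H ∧ 𝓗 = squareIntegrableSections ν S H

end DirectIntegral

end

end NullPlane

/-!
Both statements are the case of an open region `R` of the null plane whose fibres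
`{x₊ | (x₊, x_⊥) ∈ R}` are intervals (`isRealDirectIntegral_localSubspace`).

The spatial decomposition acts fibrewise on thin test functions. On the mass shell the phase
`x · p` of a point of the null plane is `x₊ exp (-θ') - ⟨x_⊥, p_⊥⟩`, so the inverse Fourier
transform in `p_⊥` undoes the transversal part of the Fourier transform, and
`V_S E(δ(x₋) f)` is, up to the factor `(2π) ^ ((D - 1) / 2)`, the field
`x_⊥ ↦ (θ' ↦ f̂(·, x_⊥)(exp (-θ')))` (`spatialDecomposition_coeFn`). The Fourier transform of
vector valued functions is defined on `L²` by extension from Schwartz functions; that it can be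
computed pointwise in `θ'` is seen by pairing with elementary tensors (`fourier_curryL2`).

For `f = ∂₊g` with `g` supported in `R` the value of this field at `x_⊥` is a generator of the
current subspace of the fibre of `R` over `x_⊥`. As the square integrable sections of a field of
closed subspaces form a closed subspace, `V_S H(R)` is contained in the direct integral.

For the converse, `V_S H(R)` contains the products `ψ k`, where `k` is the vector of `∂h` and the
tensor product of `h` and `ψ` is supported in `R`. If `supp h × U ⊆ R`, with `U` open, then all test
functions `ψ` on `U` are allowed, so that a section orthogonal to all of these products is
orthogonal to `k` at almost every point of `U`. Countably many `k` generate the current subspaces of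
all fibres: by compactness a test function supported in one fibre is supported in all fibres over a
neighbourhood of it, which can be taken from a countable basis, and `L²(ℝ)` is separable. That
fibres are intervals enters in writing a test function of integral zero as a derivative of one
supported in the same fibre (`exists_primitive`). Hence a section orthogonal to `V_S H(R)` is
orthogonal at almost every point to the closed subspace that contains its value there, and vanishes
(`isRealDirectIntegral_of_testFunctions`). The same countable family shows that the field is
measurable.
-/

namespace NullPlane

noncomputable section

/-! ### The Fourier transform of sections -/

section PartialFourier

lemma memLp_two_tensor {α β : Type*} [MeasurableSpace α] [MeasurableSpace β]
    {μ : Measure α} {ν : Measure β} [SFinite ν] {f : α → ℂ}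
    {g : β → ℂ} (hf : MemLp f 2 μ) (hg : MemLp g 2 ν) :
    MemLp (fun z : α × β => f z.1 * g z.2) 2 (μ.prod ν) := by
  refine (memLp_two_iff_integrable_sq_norm (hf.1.comp_fst.mul hg.1.comp_snd)).2 ?_
  refine (((memLp_two_iff_integrable_sq_norm hf.1).1 hf).mul_prod
    ((memLp_two_iff_integrable_sq_norm hg.1).1 hg)).congr (Filter.Eventually.of_forall fun z => ?_)
  simp [mul_pow]

lemma coeFn_sectionL2 {α β : Type*} [MeasurableSpace α] {μ : Measure α} {f : α × β → ℂ}
    {b : β} (h : MemLp (fun a => f (a, b)) 2 μ) :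
    sectionL2 μ f b =ᵐ[μ] fun a => f (a, b) := by
  rw [sectionL2, dif_pos h]
  exact h.coeFn_toLp

variable {α V : Type*} [MeasurableSpace α] {μ : Measure α} [SFinite μ]
  [MeasurableSpace.CountablyGenerated α]
  [NormedAddCommGroup V] [InnerProductSpace ℝ V] [FiniteDimensional ℝ V] [MeasurableSpace V]
  [BorelSpace V]

lemma curryL2_coeFn {β : Type*} [MeasurableSpace β] {ν : Measure β} [SFinite ν]
    (U : Lp ℂ 2 (μ.prod ν)) : curryL2 μ ν U =ᵐ[ν] sectionL2 μ U :=
  (memLp_sectionL2 U).coeFn_toLp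

/-- The elementary tensor `x ↦ ψ(x) k` as a vector valued Schwartz function. -/
def schwartzTensor {V K : Type*} [NormedAddCommGroup V] [InnerProductSpace ℝ V]
    [NormedAddCommGroup K] [NormedSpace ℂ K] (ψ : SchwartzMap V ℂ)
    (k : K) : SchwartzMap V K :=
  ψ.postcompCLM ((1 : ℂ →L[ℂ] ℂ).smulRight k)

lemma schwartzTensor_apply {V K : Type*} [NormedAddCommGroup V] [InnerProductSpace ℝ V]
    [NormedAddCommGroup K] [NormedSpace ℂ K]
    (ψ : SchwartzMap V ℂ) (k : K) (x : V) : schwartzTensor ψ k x = ψ x • k := rfl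

lemma fourier_schwartzTensor {K : Type*} [NormedAddCommGroup K] [NormedSpace ℂ K]
    [CompleteSpace K] (ψ : SchwartzMap V ℂ) (k : K) :
    𝓕 (schwartzTensor ψ k) = schwartzTensor (𝓕 ψ) k := by
  ext x
  rw [schwartzTensor_apply, SchwartzMap.fourier_coe, SchwartzMap.fourier_coe, Real.fourier_eq,
    Real.fourier_eq, ← integral_smul_const]
  simp only [schwartzTensor_apply, smul_assoc]

/-- The pairing with the elementary tensors determines a square integrable vector valued
function. -/
lemma eq_of_inner_schwartzTensor {K : Type*} [NormedAddCommGroup K] [InnerProductSpace ℂ K]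
    [CompleteSpace K] [SecondCountableTopology K] {u v : Lp K 2 (volume : Measure V)}
    (h : ∀ (ψ : SchwartzMap V ℂ) (k : K),
      inner ℂ u ((schwartzTensor ψ k).toLp 2) = inner ℂ v ((schwartzTensor ψ k).toLp 2)) :
    u = v := by
  rw [← sub_eq_zero]
  set w := u - v
  have hw : ∀ (ψ : SchwartzMap V ℂ) (k : K), inner ℂ ((schwartzTensor ψ k).toLp 2) w = 0 := by
    intro ψ k
    rw [← inner_conj_symm, inner_sub_left, h, sub_self, map_zero]
  refine Lp.ext ((ae_eq_zero_of_forall_inner (𝕜 := ℂ) fun k => ?_).trans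
    (Lp.coeFn_zero K 2 _).symm)
  have hloc : LocallyIntegrable (fun x => inner ℂ k (w x)) volume :=
    ((Lp.memLp w).const_inner k).locallyIntegrable (by norm_num)
  refine ae_eq_zero_of_integral_contDiff_smul_eq_zero hloc fun g hg hgc => ?_
  have hg' : ContDiff ℝ ∞ fun x => (g x : ℂ) := Complex.ofRealCLM.contDiff.comp hg
  have hgc' : HasCompactSupport fun x => (g x : ℂ) := hgc.comp_left (g := Complex.ofReal) rfl
  rw [← hw (hgc'.toSchwartzMap hg') k, L2.inner_def]
  refine integral_congr_ae ?_
  filter_upwards [(schwartzTensor (hgc'.toSchwartzMap hg') k).coeFn_toLp 2 volume] with x hx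
  rw [hx, schwartzTensor_apply, inner_smul_left]
  simp

/-- The pairing of `x ↦ U(·, x)` with an elementary tensor as an iterated integral in the reverse
order, which leaves the inner integral over `V` at a fixed point of `α`. -/
lemma inner_curryL2_schwartzTensor (U : Lp ℂ 2 (μ.prod (volume : Measure V)))
    (ψ : SchwartzMap V ℂ) (k : Lp ℂ 2 μ) :
    inner ℂ (curryL2 μ volume U) ((schwartzTensor ψ k).toLp 2) =
      ∫ a, k a * ∫ x, (starRingEnd ℂ) (U (a, x)) * ψ x ∂volume ∂μ := by
  have hint : Integrable (fun z : α × V => k z.1 * ((starRingEnd ℂ) (U z) * ψ z.2))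
      (μ.prod volume) := by
    have h1 : MemLp (fun z => (starRingEnd ℂ) (U z)) 2 (μ.prod (volume : Measure V)) :=
      (Lp.memLp U).star
    have h2 := memLp_two_tensor (Lp.memLp k) (ψ.memLp 2 (volume : Measure V))
    refine (h1.integrable_mul h2).congr (Filter.Eventually.of_forall fun z => ?_)
    simp only [Pi.mul_apply]
    ring
  simp only [← integral_const_mul]
  rw [integral_integral_swap hint, L2.inner_def]
  refine integral_congr_ae ?_
  filter_upwards [(schwartzTensor ψ k).coeFn_toLp 2 volume, curryL2_coeFn U,
    ae_memLp_section (Lp.memLp U)] with x h1 h2 h3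
  rw [h1, h2, schwartzTensor_apply, inner_smul_right, L2.inner_def, ← integral_const_mul]
  refine integral_congr_ae ?_
  filter_upwards [coeFn_sectionL2 h3] with a ha
  rw [ha, RCLike.inner_apply]
  ring

/-- If `U(a, ·)` is the Fourier transform of the integrable function `W(a, ·)` for almost every
`a`, then the Fourier transform of `x ↦ W(·, x)`, as a vector valued function, is `x ↦ U(·, x)`. -/
lemma fourier_curryL2 {U W : Lp ℂ 2 (μ.prod (volume : Measure V))}
    (hW : ∀ᵐ a ∂μ, Integrable fun x => W (a, x))
    (h : ∀ᵐ a ∂μ, (fun x => U (a, x)) =ᵐ[volume] 𝓕 fun x => W (a, x)) :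
    (Lp.fourierTransformₗᵢ V (Lp ℂ 2 μ)).symm (curryL2 μ volume U) = curryL2 μ volume W := by
  have : Fact ((2 : ENNReal) ≠ ⊤) := ⟨by norm_num⟩
  refine eq_of_inner_schwartzTensor fun ψ k => ?_
  rw [← (Lp.fourierTransformₗᵢ V (Lp ℂ 2 μ)).inner_map_map, LinearIsometryEquiv.apply_symm_apply]
  change inner ℂ _ (𝓕 ((schwartzTensor ψ k).toLp 2)) = _
  rw [SchwartzMap.toLp_fourier_eq, fourier_schwartzTensor, inner_curryL2_schwartzTensor,
    inner_curryL2_schwartzTensor]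
  refine integral_congr_ae ?_
  filter_upwards [hW, h] with a ha hU
  congr 1
  have hφ : 𝓕⁻ (𝓕 ψ : SchwartzMap V ℂ) = ψ := FourierTransform.fourierInv_fourier_eq ψ
  -- for fixed `a`, the adjoint of the Fourier transform of an integrable function against a
  -- Schwartz function `φ` is the inverse Fourier transform of `φ`
  generalize (𝓕 ψ : SchwartzMap V ℂ) = φ at hφ ⊢
  subst hφ
  calc ∫ x, (starRingEnd ℂ) (U (a, x)) * φ x
      = ∫ x, (starRingEnd ℂ) (𝓕 (fun y => W (a, y)) x) * φ x := by
        refine integral_congr_ae ?_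
        filter_upwards [hU] with x hx
        rw [← hx]
    _ = ∫ x, (starRingEnd ℂ) (W (a, x)) * 𝓕⁻ (φ : V → ℂ) x := by
        simp only [mul_comm ((starRingEnd ℂ) _)]
        simpa using! VectorFourier.integral_sesq_fourierIntegral_eq_neg_flip (innerSL ℂ)
          (L := innerₗ V) Real.continuous_fourierChar continuous_inner ha
          (φ.integrable (μ := volume))
    _ = ∫ x, (starRingEnd ℂ) (W (a, x)) * (𝓕⁻ φ : SchwartzMap V ℂ) x := by
        rw [SchwartzMap.fourierInv_coe]

end PartialFourier

/-! ### Fourier transforms on the null plane -/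

section PlaneFourier

variable {D : ℕ}

/-- The Fourier transform of `f(·, x_⊥)` in the variable `x₊`, as a function of `(θ', x_⊥)` where
`p₋ = exp (-θ')`. -/
def plusTransform (f : NPlane D → ℝ) (z : ℝ × Perp D) : ℂ :=
  fourierLine (fun t => f (t, z.2)) (Real.exp (-z.1))

lemma stronglyMeasurable_plusTransform {f : NPlane D → ℝ} (hf : Continuous f) :
    StronglyMeasurable (plusTransform f) := by
  unfold plusTransform fourierLine
  refine StronglyMeasurable.integral_prod_right (f := fun (z : ℝ × Perp D) (t : ℝ) =>
    Complex.exp (Complex.I * ((t * Real.exp (-z.1) : ℝ) : ℂ)) * (f (t, z.2) : ℂ)) ?_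
  refine Continuous.stronglyMeasurable ?_
  unfold Function.uncurry
  fun_prop

lemma stronglyMeasurable_thinFourier {f : NPlane D → ℝ} (hf : Continuous f) :
    StronglyMeasurable (thinFourier f) := by
  unfold thinFourier
  refine StronglyMeasurable.integral_prod_right (f := fun (p : Mink D) (y : NPlane D) =>
    Complex.exp (Complex.I * (minkProd (lightPoint y.1 0 y.2) p : ℝ)) * (f y : ℂ)) ?_
  refine Continuous.stronglyMeasurable ?_
  unfold Function.uncurry minkProd lightPoint
  fun_prop

lemma minkProd_lightPoint_shellPoint (m t θ : ℝ) (x p : Perp D) :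
    minkProd (lightPoint t 0 x) (shellPoint m (θ, p)) = t * Real.exp (-θ) - inner ℝ x p := by
  have h2 : (√2 : ℝ) * √2 = 2 := Real.mul_self_sqrt (by norm_num)
  simp only [minkProd, shellPoint, lightPoint, add_zero, sub_zero, div_mul_div_comm, h2]
  ring

lemma integrable_phase_mul {f : NPlane D → ℝ} (hf : Continuous f) (hc : HasCompactSupport f)
    (θ : ℝ) : Integrable fun y : NPlane D =>
      Complex.exp (Complex.I * ((y.1 * Real.exp (-θ) : ℝ) : ℂ)) * (f y : ℂ) := by
  refine Continuous.integrable_of_hasCompactSupport (by fun_prop) ?_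
  exact (hc.comp_left (g := Complex.ofReal) rfl).mul_left

lemma integrable_plusTransform {f : NPlane D → ℝ} (hf : Continuous f) (hc : HasCompactSupport f)
    (θ : ℝ) : Integrable fun x => plusTransform f (θ, x) :=
  (integrable_phase_mul hf hc θ).integral_prod_right

/-- On the mass shell the thin Fourier transform is the transversal Fourier transform of
`plusTransform`, up to the normalisation of the Fourier transform. -/
lemma thinFourier_shellPoint {f : NPlane D → ℝ} (hf : Continuous f) (hc : HasCompactSupport f)
    (m θ : ℝ) (p : Perp D) :
    thinFourier f (shellPoint m (θ, p)) =
      𝓕 (fun y : Perp D => ((2 * Real.pi) ^ Module.finrank ℝ (Perp D) : ℝ) •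
        plusTransform f (θ, (2 * Real.pi) • y)) p := by
  have hπ : 0 < 2 * Real.pi := Real.two_pi_pos
  have h1 : thinFourier f (shellPoint m (θ, p)) =
      ∫ x : Perp D,
        Complex.exp (((-inner ℝ x p : ℝ) : ℂ) * Complex.I) * plusTransform f (θ, x) := by
    have hint : Integrable fun y : NPlane D =>
        Complex.exp (((-inner ℝ y.2 p : ℝ) : ℂ) * Complex.I) *
          (Complex.exp (Complex.I * ((y.1 * Real.exp (-θ) : ℝ) : ℂ)) * (f y : ℂ)) := by
      refine (integrable_phase_mul hf hc θ).bdd_mul (c := 1) ?_ ?_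
      · exact Continuous.aestronglyMeasurable (by fun_prop)
      · exact Filter.Eventually.of_forall fun y => (Complex.norm_exp_ofReal_mul_I _).le
    simp only [plusTransform, fourierLine, ← integral_const_mul]
    rw [Measure.volume_eq_prod] at hint
    rw [← integral_prod_symm _ hint, thinFourier, ← Measure.volume_eq_prod]
    congr 1
    funext y
    rw [minkProd_lightPoint_shellPoint, ← mul_assoc, ← Complex.exp_add]
    congr 2
    push_cast
    ring
  have h2 := Measure.integral_comp_smul_of_nonneg (volume : Measure (Perp D)) (fun x : Perp D =>
    Complex.exp (((-inner ℝ x p : ℝ) : ℂ) * Complex.I) * plusTransform f (θ, x)) (2 * Real.pi)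
    (hR := hπ.le)
  rw [eq_inv_smul_iff₀ (pow_pos hπ _).ne'] at h2
  rw [h1, ← h2, Real.fourier_eq', ← integral_smul]
  congr 1
  funext y
  rw [inner_smul_left, smul_eq_mul, mul_smul_comm]
  simp

lemma memLp_dilation_right {F : ℝ × Perp D → ℂ} (hF : MemLp F 2 volume) {c : ℝ} (hc : 0 < c) :
    MemLp (fun z : ℝ × Perp D => F (z.1, c • z.2)) 2 volume := by
  have h := (MeasurePreserving.id (volume : Measure ℝ)).prod
    (measurePreserving_dilation (V := Perp D) hc)
  rw [Measure.prod_smul_right] at h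
  exact (hF.smul_measure ENNReal.ofReal_ne_top).comp_measurePreserving h

lemma sectionL2_eq_of_forall {α β γ : Type*} [MeasurableSpace α] {μ : Measure α} {f : α × β → ℂ}
    {g : α × γ → ℂ} {b : β} {c : γ} (h : ∀ a, f (a, b) = g (a, c)) :
    sectionL2 μ f b = sectionL2 μ g c := by
  have h' : (fun a => f (a, b)) = fun a => g (a, c) := funext h
  unfold sectionL2
  rw [h']

lemma sectionL2_const_smul {α β : Type*} [MeasurableSpace α] {μ : Measure α} {f : α × β → ℂ}
    {b : β} (h : MemLp (fun a => f (a, b)) 2 μ) (c : ℝ) :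
    sectionL2 μ (fun z => c • f z) b = c • sectionL2 μ f b := by
  rw [sectionL2, sectionL2, dif_pos h]
  exact (dif_pos (h.const_smul c)).trans (MemLp.toLp_const_smul c h)

lemma momentumDecomposition_coeFn (hD : 1 < D) (m : ℝ) (ξ : OneParticle D m) :
    momentumDecomposition hD m ξ =ᵐ[volume] fun z => ξ (shellPoint m z) :=
  Lp.coeFn_compMeasurePreserving ξ (measurePreserving_shellPoint hD m)

lemma dilationL2_coeFn {V F : Type*} [NormedAddCommGroup V] [InnerProductSpace ℝ V]
    [FiniteDimensional ℝ V] [MeasurableSpace V] [BorelSpace V] [NormedAddCommGroup F]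
    [NormedSpace ℂ F] {c : ℝ} (hc : 0 < c) (f : Lp F 2 (volume : Measure V)) :
    dilationL2 V F hc f =ᵐ[volume]
      fun x => (Real.sqrt (c ^ Module.finrank ℝ V) : ℂ) • f (c • x) := by
  set g : Lp F 2 (volume : Measure V) := (memLp_dilation hc (Lp.memLp f)).toLp _
  refine (Lp.coeFn_smul (Real.sqrt (c ^ Module.finrank ℝ V) : ℂ) g).trans ?_
  filter_upwards [(memLp_dilation hc (Lp.memLp f)).coeFn_toLp] with x hx
  rw [Pi.smul_apply, hx]

/-- The normalisation constant `(2π) ^ ((D - 1) / 2)` of the spatial decomposition of a thin test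
function. -/
def transversalConst (D : ℕ) : ℝ :=
  Real.sqrt (((2 * Real.pi)⁻¹) ^ Module.finrank ℝ (Perp D)) *
    (2 * Real.pi) ^ Module.finrank ℝ (Perp D)

lemma transversalConst_pos (D : ℕ) : 0 < transversalConst D := by
  unfold transversalConst
  positivity

/-- The spatial decomposition of a thin test function acts fibrewise: it is the Fourier transform
in `x₊` alone, up to a constant. -/
lemma spatialDecomposition_coeFn (hD : 1 < D) {m : ℝ} {f : NPlane D → ℝ} (hf : Continuous f)
    (hc : HasCompactSupport f) (hL : MemLp (plusTransform f) 2 volume) {ξ : OneParticle D m}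
    (hξ : ξ =ᵐ[massShellMeasure D m] thinFourier f) :
    spatialDecomposition hD m ξ =ᵐ[volume]
      fun x => transversalConst D • sectionL2 volume (plusTransform f) x := by
  have hπ : 0 < 2 * Real.pi := Real.two_pi_pos
  -- `W₀` compensates for the factor `2π` in the phase of Mathlib's Fourier transform; the dilation
  -- in the definition of `inverseFourierL2` scales it back
  set d := Module.finrank ℝ (Perp D)
  set W₀ : ℝ × Perp D → ℂ := fun z =>
    ((2 * Real.pi) ^ d : ℝ) • plusTransform f (z.1, (2 * Real.pi) • z.2) with hW₀
  have hWm : MemLp W₀ 2 (volume.prod volume) :=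
    (memLp_dilation_right hL hπ).const_smul ((2 * Real.pi) ^ d : ℝ)
  have hU : momentumDecomposition hD m ξ =ᵐ[volume.prod volume]
      fun z => thinFourier f (shellPoint m z) := by
    refine (momentumDecomposition_coeFn hD m ξ).trans ?_
    exact (measurePreserving_shellPoint hD m).quasiMeasurePreserving.ae hξ
  have hWae := Measure.ae_ae_of_ae_prod hWm.coeFn_toLp
  have key := fourier_curryL2 (U := momentumDecomposition hD m ξ) (W := hWm.toLp W₀) (by
      filter_upwards [hWae] with θ hθ
      refine Integrable.congr ?_ (Filter.EventuallyEq.symm hθ)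
      exact ((integrable_plusTransform hf hc θ).comp_smul hπ.ne').smul ((2 * Real.pi) ^ d : ℝ)) (by
      filter_upwards [hWae, Measure.ae_ae_of_ae_prod hU] with θ hθ hθ'
      filter_upwards [hθ'] with p hp
      rw [hp, thinFourier_shellPoint hf hc]
      exact (Real.fourier_congr_ae hθ p).symm)
  have h1 : spatialDecomposition hD m ξ = dilationL2 (Perp D) HU1 (inv_pos.2 hπ)
      (curryL2 volume volume (hWm.toLp W₀)) := by
    rw [← key]
    rfl
  rw [h1]
  refine (dilationL2_coeFn _ _).trans ?_
  filter_upwards [ae_dilation (inv_pos.2 hπ) ((curryL2_coeFn (hWm.toLp W₀)).trans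
    (sectionL2_congr hWm.coeFn_toLp)), ae_memLp_section (ν := volume) hL] with x hx hm
  have h2 : sectionL2 volume W₀ ((2 * Real.pi)⁻¹ • x) =
      sectionL2 volume (fun z => ((2 * Real.pi) ^ d : ℝ) • plusTransform f z) x :=
    sectionL2_eq_of_forall fun a => by simp only [hW₀, smul_inv_smul₀ hπ.ne']
  rw [hx, h2, sectionL2_const_smul hm, transversalConst, mul_smul]
  exact (RCLike.real_smul_eq_coe_smul (K := ℂ) _ _).symm

end PlaneFourier

/-! ### Decay of the Fourier transform of a derivative -/

section Decay

variable {D : ℕ}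

lemma norm_fourierLine_le (g : ℝ → ℝ) (p : ℝ) : ‖fourierLine g p‖ ≤ ∫ t, ‖g t‖ := by
  refine (norm_integral_le_integral_norm _).trans_eq ?_
  congr 1
  funext t
  rw [norm_mul, mul_comm Complex.I, Complex.norm_exp_ofReal_mul_I, one_mul, Complex.norm_real]

lemma fourierLine_deriv {g : ℝ → ℝ} (hg : ContDiff ℝ 1 g) (hc : HasCompactSupport g) (p : ℝ) :
    fourierLine (deriv g) p = -(Complex.I * p) * fourierLine g p := by
  have hd : Continuous (deriv g) := hg.continuous_deriv le_rfl
  have hgc : HasCompactSupport fun t => (g t : ℂ) := hc.comp_left (g := Complex.ofReal) rfl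
  have hdc : HasCompactSupport fun t => ((deriv g t : ℝ) : ℂ) :=
    hc.deriv.comp_left (g := Complex.ofReal) rfl
  have hgk := hg.continuous
  have h := integral_mul_deriv_eq_deriv_mul_of_integrable
    (u := fun t : ℝ => Complex.exp (Complex.I * ((t * p : ℝ) : ℂ))) (v := fun t => (g t : ℂ))
    (u' := fun t : ℝ => Complex.I * p * Complex.exp (Complex.I * ((t * p : ℝ) : ℂ)))
    (v' := fun t => ((deriv g t : ℝ) : ℂ)) (fun t _ => by
      have h1 : HasDerivAt (fun t : ℝ => Complex.I * ((t * p : ℝ) : ℂ)) (Complex.I * p) t := by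
        have := (((hasDerivAt_id t).mul_const p).ofReal_comp).const_mul Complex.I
        simpa using this
      simpa [mul_comm] using h1.cexp)
    (fun t _ => ((hg.differentiable one_ne_zero t).hasDerivAt).ofReal_comp)
    (Continuous.integrable_of_hasCompactSupport (by fun_prop) hdc.mul_left)
    (Continuous.integrable_of_hasCompactSupport (by fun_prop) hgc.mul_left)
    (Continuous.integrable_of_hasCompactSupport (by fun_prop) hgc.mul_left)
  rw [fourierLine, h, fourierLine, ← integral_neg, ← integral_const_mul]
  congr 1
  funext t
  ring

lemma fourierLine_deriv_zero {g : ℝ → ℝ} (hg : ContDiff ℝ 1 g) (hc : HasCompactSupport g) :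
    fourierLine (deriv g) 0 = 0 := by
  rw [fourierLine_deriv hg hc]
  simp

/-- The function `θ' ↦ ĝ'(exp (-θ'))` decays exponentially at both ends: at `+∞` because `ĝ'`
vanishes to first order at zero momentum, at `-∞` because `g'` is differentiable. -/
lemma norm_fourierLine_deriv_exp_le {g : ℝ → ℝ} (hg : ContDiff ℝ 2 g) (hc : HasCompactSupport g)
    (θ : ℝ) : ‖fourierLine (deriv g) (Real.exp (-θ))‖ ≤
      ((∫ t, ‖g t‖) + ∫ t, ‖deriv (deriv g) t‖) * Real.exp (-|θ|) := by
  have hg1 : ContDiff ℝ 1 g := hg.of_le (by norm_num)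
  have hg2 : ContDiff ℝ 1 (deriv g) := ((contDiff_succ_iff_deriv (n := 1)).1 hg).2.2
  have h0 : 0 ≤ ∫ t, ‖g t‖ := integral_nonneg fun t => norm_nonneg _
  have h0' : 0 ≤ ∫ t, ‖deriv (deriv g) t‖ := integral_nonneg fun t => norm_nonneg _
  have hn : ‖-(Complex.I * (Real.exp (-θ) : ℂ))‖ = Real.exp (-θ) := by
    rw [norm_neg, norm_mul, Complex.norm_I, one_mul, Complex.norm_real, Real.norm_eq_abs,
      Real.abs_exp]
  rcases le_total 0 θ with hθ | hθ
  · rw [abs_of_nonneg hθ, fourierLine_deriv hg1 hc, norm_mul, hn, mul_comm]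
    gcongr
    linarith [norm_fourierLine_le g (Real.exp (-θ))]
  · have h1 := norm_fourierLine_le (deriv (deriv g)) (Real.exp (-θ))
    rw [fourierLine_deriv hg2 hc.deriv, norm_mul, hn] at h1
    rw [abs_of_nonpos hθ, neg_neg]
    have h2 : Real.exp θ * Real.exp (-θ) = 1 := by rw [← Real.exp_add]; simp
    calc ‖fourierLine (deriv g) (Real.exp (-θ))‖
        = (Real.exp (-θ) * ‖fourierLine (deriv g) (Real.exp (-θ))‖) * Real.exp θ := by
          linear_combination (-‖fourierLine (deriv g) (Real.exp (-θ))‖) * h2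
      _ ≤ _ := by
          gcongr
          linarith

lemma memLp_exp_neg_abs : MemLp (fun θ : ℝ => ((Real.exp (-|θ|) : ℝ) : ℂ)) 2 volume := by
  refine (memLp_two_iff_integrable_sq_norm
    (Continuous.aestronglyMeasurable (by fun_prop))).2 ?_
  have h : (fun θ : ℝ => ‖((Real.exp (-|θ|) : ℝ) : ℂ)‖ ^ 2) = fun θ => Real.exp (-2 * |θ|) := by
    funext θ
    rw [Complex.norm_real, Real.norm_eq_abs, Real.abs_exp, ← Real.exp_nat_mul]
    congr 1
    push_cast
    ring
  rw [h]
  rw [← integrableOn_univ, ← Iic_union_Ioi (a := (0 : ℝ))]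
  refine IntegrableOn.union ?_ ?_
  · refine (integrableOn_exp_mul_Iic (a := 2) (by norm_num) 0).congr_fun (fun t ht => ?_)
      measurableSet_Iic
    simp only [abs_of_nonpos (mem_Iic.1 ht), neg_mul_neg]
  · refine (integrableOn_exp_mul_Ioi (a := -2) (by norm_num) 0).congr_fun (fun t ht => ?_)
      measurableSet_Ioi
    simp only [abs_of_pos (mem_Ioi.1 ht)]

lemma memLp_fourierLine_deriv {g : ℝ → ℝ} (hg : ContDiff ℝ 2 g) (hc : HasCompactSupport g) :
    MemLp (fun θ => fourierLine (deriv g) (Real.exp (-θ))) 2 volume := by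
  have hd : Continuous (deriv g) := hg.continuous_deriv (by norm_num)
  have hm : StronglyMeasurable fun θ => fourierLine (deriv g) (Real.exp (-θ)) := by
    unfold fourierLine
    refine StronglyMeasurable.integral_prod_right (f := fun (θ t : ℝ) =>
      Complex.exp (Complex.I * ((t * Real.exp (-θ) : ℝ) : ℂ)) * ((deriv g t : ℝ) : ℂ)) ?_
    refine Continuous.stronglyMeasurable ?_
    unfold Function.uncurry
    fun_prop
  refine (memLp_exp_neg_abs.const_mul
    (((∫ t, ‖g t‖) + ∫ t, ‖deriv (deriv g) t‖ : ℝ) : ℂ)).of_le hm.aestronglyMeasurable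
    (Filter.Eventually.of_forall fun θ => (norm_fourierLine_deriv_exp_le hg hc θ).trans ?_)
  rw [norm_mul, Complex.norm_real, Complex.norm_real, Real.norm_eq_abs, Real.norm_eq_abs,
    Real.abs_exp]
  gcongr
  exact le_abs_self _

lemma derivPlus_eq_fderiv {g : NPlane D → ℝ} (hg : ContDiff ℝ ∞ g) :
    derivPlus g = fun y => fderiv ℝ g y (1, 0) := by
  funext y
  have h1 : HasDerivAt (fun t : ℝ => ((t, y.2) : NPlane D)) (1, 0) y.1 :=
    (hasDerivAt_id y.1).prodMk (hasDerivAt_const y.1 y.2)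
  exact ((hg.differentiable (by simp) (y.1, y.2)).hasFDerivAt.comp_hasDerivAt y.1 h1).deriv

lemma contDiff_derivPlus {g : NPlane D → ℝ} (hg : ContDiff ℝ ∞ g) :
    ContDiff ℝ ∞ (derivPlus g) := by
  rw [derivPlus_eq_fderiv hg]
  exact (hg.fderiv_right (m := ∞) (by simp)).clm_apply contDiff_const

lemma hasCompactSupport_derivPlus {g : NPlane D → ℝ} (hg : ContDiff ℝ ∞ g)
    (hc : HasCompactSupport g) : HasCompactSupport (derivPlus g) := by
  rw [derivPlus_eq_fderiv hg]
  exact hc.fderiv_apply ℝ (1, 0)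

lemma contDiff_slice {g : NPlane D → ℝ} (hg : ContDiff ℝ ∞ g) (x : Perp D) :
    ContDiff ℝ ∞ fun t => g (t, x) :=
  hg.comp (contDiff_id.prodMk contDiff_const)

lemma tsupport_slice_subset (g : NPlane D → ℝ) (x : Perp D) :
    tsupport (fun t => g (t, x)) ⊆ (fun t => (t, x)) ⁻¹' tsupport g :=
  tsupport_comp_subset_preimage g (by fun_prop)

lemma hasCompactSupport_slice {g : NPlane D → ℝ} (hc : HasCompactSupport g) (x : Perp D) :
    HasCompactSupport fun t => g (t, x) :=
  HasCompactSupport.intro (IsCompact.image hc continuous_fst) fun _ ht =>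
    image_eq_zero_of_notMem_tsupport fun h => ht ⟨_, h, rfl⟩

lemma exists_integral_slice_le {f : NPlane D → ℝ} (hf : Continuous f) (hc : HasCompactSupport f) :
    ∃ C, ∀ x, ∫ t, ‖f (t, x)‖ ≤ C := by
  obtain ⟨M, hM⟩ := hc.exists_bound_of_continuous hf
  set K : Set ℝ := Prod.fst '' tsupport f
  have hK : IsCompact K := IsCompact.image hc continuous_fst
  refine ⟨M * volume.real K, fun x => ?_⟩
  rw [← setIntegral_eq_integral_of_forall_compl_eq_zero (s := K) fun _ ht => by
    rw [image_eq_zero_of_notMem_tsupport fun h => ht ⟨_, h, rfl⟩, norm_zero]]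
  refine (le_abs_self _).trans ?_
  rw [← Real.norm_eq_abs]
  refine norm_setIntegral_le_of_norm_le_const hK.measure_lt_top fun t _ => ?_
  rw [norm_norm]
  exact hM _

/-- The exponential decay in `θ'` is uniform in `x_⊥`, and the support in `x_⊥` is compact. -/
lemma memLp_plusTransform_derivPlus {g : NPlane D → ℝ} (hg : ContDiff ℝ ∞ g)
    (hc : HasCompactSupport g) : MemLp (plusTransform (derivPlus g)) 2 volume := by
  have hg1 := contDiff_derivPlus hg
  have hc1 := hasCompactSupport_derivPlus hg hc
  obtain ⟨A, hA⟩ := exists_integral_slice_le hg.continuous hc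
  obtain ⟨B, hB⟩ := exists_integral_slice_le (contDiff_derivPlus hg1).continuous
    (hasCompactSupport_derivPlus hg1 hc1)
  set K : Set (Perp D) := Prod.snd '' tsupport (derivPlus g)
  have hK : IsCompact K := hc1.image continuous_snd
  refine (memLp_two_tensor memLp_exp_neg_abs (memLp_indicator_const 2 hK.measurableSet
    ((A + B : ℝ) : ℂ) (Or.inr hK.measure_lt_top.ne))).of_le
    (stronglyMeasurable_plusTransform hg1.continuous).aestronglyMeasurable
    (Filter.Eventually.of_forall fun z => ?_)
  by_cases hz : z.2 ∈ K
  · have h := norm_fourierLine_deriv_exp_le ((contDiff_slice hg z.2).of_le (by norm_cast))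
      (hasCompactSupport_slice hc z.2) z.1
    refine h.trans ?_
    rw [indicator_of_mem hz, norm_mul, Complex.norm_real, Complex.norm_real, Real.norm_eq_abs,
      Real.abs_exp, mul_comm]
    gcongr
    exact (add_le_add (hA z.2) (hB z.2)).trans (le_abs_self _)
  · have h0 : ∀ t, derivPlus g (t, z.2) = 0 := fun t =>
      image_eq_zero_of_notMem_tsupport fun h => hz ⟨_, h, rfl⟩
    simp [plusTransform, fourierLine, h0]

end Decay

/-! ### Real direct integrals -/

section DirectIntegral

/-- The square integrable sections of a field of closed real subspaces form a real subspace. -/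
def sectionsSubmodule {X K : Type*} [MeasurableSpace X] [NormedAddCommGroup K] [NormedSpace ℝ K]
    (ν : Measure X) (S : Set X) (H : X → Submodule ℝ K) : Submodule ℝ (Lp K 2 ν) where
  carrier := squareIntegrableSections ν S H
  zero_mem' := by
    constructor
    · filter_upwards [Lp.coeFn_zero K 2 ν] with x hx _
      rw [hx]
      exact (H x).zero_mem
    · filter_upwards [Lp.coeFn_zero K 2 ν] with x hx _
      rw [hx, Pi.zero_apply]
  add_mem' := by
    rintro f g ⟨hf, hf'⟩ ⟨hg, hg'⟩
    constructor
    · filter_upwards [Lp.coeFn_add f g, hf, hg] with x hx h1 h2 hS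
      rw [hx]
      exact (H x).add_mem (h1 hS) (h2 hS)
    · filter_upwards [Lp.coeFn_add f g, hf', hg'] with x hx h1 h2 hS
      rw [hx, Pi.add_apply, h1 hS, h2 hS, add_zero]
  smul_mem' := by
    rintro c f ⟨hf, hf'⟩
    constructor
    · filter_upwards [Lp.coeFn_smul c f, hf] with x hx h1 hS
      rw [hx]
      exact (H x).smul_mem c (h1 hS)
    · filter_upwards [Lp.coeFn_smul c f, hf'] with x hx h1 hS
      rw [hx, Pi.smul_apply, h1 hS, smul_zero]

lemma isClosed_squareIntegrableSections {X K : Type*} [MeasurableSpace X] [NormedAddCommGroup K]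
    [NormedSpace ℝ K] (ν : Measure X) (S : Set X) {H : X → Submodule ℝ K}
    (hH : ∀ x ∈ S, IsClosed (H x : Set K)) : IsClosed (squareIntegrableSections ν S H) := by
  refine IsSeqClosed.isClosed fun u f hu hf => ?_
  have h1 : TendstoInMeasure ν (fun n => (u n : X → K)) Filter.atTop f :=
    tendstoInMeasure_of_tendsto_Lp hf
  obtain ⟨φ, -, hφ⟩ := h1.exists_seq_tendsto_ae
  have hu1 : ∀ᵐ x ∂ν, ∀ n, x ∈ S → u (φ n) x ∈ H x := ae_all_iff.2 fun n => (hu (φ n)).1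
  have hu2 : ∀ᵐ x ∂ν, ∀ n, x ∉ S → u (φ n) x = 0 := ae_all_iff.2 fun n => (hu (φ n)).2
  constructor
  · filter_upwards [hφ, hu1] with x hx h hS
    exact (hH x hS).mem_of_tendsto hx (Filter.Eventually.of_forall fun n => h n hS)
  · filter_upwards [hφ, hu2] with x hx h hS
    exact tendsto_nhds_unique hx (by simp only [h _ hS, tendsto_const_nhds_iff])

/-- A closed space `N` of square integrable sections is the whole direct integral if it contains
the products `ψ k i` of the vectors of a countable family with the test functions `ψ` on open sets
`U i`, and the family is fibrewise total: a section orthogonal to `N` is orthogonal to `k i` almost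
everywhere on `U i`, hence vanishes. -/
lemma isRealDirectIntegral_of_testFunctions {V K : Type*} [NormedAddCommGroup V]
    [NormedSpace ℝ V] [FiniteDimensional ℝ V] [MeasurableSpace V] [BorelSpace V]
    [NormedAddCommGroup K] [InnerProductSpace ℝ K] [CompleteSpace K] {ν : Measure V}
    [IsLocallyFiniteMeasure ν] {S : Set V} (hS : MeasurableSet S) {H : V → Submodule ℝ K}
    {N : Submodule ℝ (Lp K 2 ν)} (hN : IsClosed (N : Set (Lp K 2 ν)))
    (hNH : (N : Set (Lp K 2 ν)) ⊆ squareIntegrableSections ν S H)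
    {ι : Type*} [Countable ι] [Nonempty ι] (U : ι → Set V) (k : ι → K) (hU : ∀ i, IsOpen (U i))
    (hk : ∀ x ∈ S, H x = (Submodule.span ℝ
      (range fun i => (U i).indicator (fun _ => k i) x)).topologicalClosure)
    (htest : ∀ i (ψ : V → ℝ), ContDiff ℝ ∞ ψ → HasCompactSupport ψ → tsupport ψ ⊆ U i →
      ∃ η ∈ N, η =ᵐ[ν] fun x => ψ x • k i) :
    IsRealDirectIntegral ν S H N := by
  obtain ⟨e, he⟩ := exists_surjective_nat ι
  have hrange : ∀ x, (range fun n => (U (e n)).indicator (fun _ => k (e n)) x) =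
      range fun i => (U i).indicator (fun _ => k i) x := fun x =>
    he.range_comp fun i => (U i).indicator (fun _ => k i) x
  refine ⟨⟨fun n => (U (e n)).indicator fun _ => k (e n), fun n => ?_, ?_⟩, hNH.antisymm ?_⟩
  · exact (stronglyMeasurable_const.indicator (hU _).measurableSet).aestronglyMeasurable
  · refine ae_restrict_of_forall_mem hS fun x hx => ?_
    rw [hrange, hk x hx]
  -- a section orthogonal to `N` vanishes
  have key : ∀ ζ ∈ squareIntegrableSections ν S H, ζ ∈ Nᗮ → ζ = 0 := by
    rintro ζ ⟨h1, h2⟩ hζ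
    have h3 : ∀ i, ∀ᵐ x ∂ν, x ∈ U i → inner ℝ (k i) (ζ x) = 0 := by
      intro i
      have hloc : LocallyIntegrable (fun x => inner ℝ (k i) (ζ x)) ν :=
        ((Lp.memLp ζ).const_inner (𝕜 := ℝ) (k i)).locallyIntegrable (by norm_num)
      refine (hU i).ae_eq_zero_of_integral_contDiff_smul_eq_zero (hloc.locallyIntegrableOn _)
        fun ψ hψ hψc hψU => ?_
      obtain ⟨η, hη, hη'⟩ := htest i ψ hψ hψc hψU
      rw [← (Submodule.mem_orthogonal N ζ).1 hζ η hη, L2.inner_def]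
      refine integral_congr_ae ?_
      filter_upwards [hη'] with x hx
      rw [hx, real_inner_smul_left, smul_eq_mul]
    refine Lp.ext (Filter.EventuallyEq.trans ?_ (Lp.coeFn_zero K 2 ν).symm)
    filter_upwards [h1, h2, ae_all_iff.2 h3] with x hx1 hx2 hx3
    by_cases hxS : x ∈ S
    · have hmem := hx1 hxS
      rw [hk x hxS] at hmem
      have hle : (Submodule.span ℝ
          (range fun i => (U i).indicator (fun _ => k i) x)).topologicalClosure ≤
          (Submodule.span ℝ {ζ x})ᗮ := by
        refine Submodule.topologicalClosure_minimal _ (Submodule.span_le.2 ?_)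
          (Submodule.isClosed_orthogonal _)
        rintro _ ⟨i, rfl⟩
        refine Submodule.mem_orthogonal_singleton_iff_inner_left.2 ?_
        by_cases hi : x ∈ U i
        · simpa [hi] using hx3 i hi
        · simp [hi]
      exact inner_self_eq_zero.1 (Submodule.mem_orthogonal_singleton_iff_inner_left.1 (hle hmem))
    · exact hx2 hxS
  intro ξ hξ
  have : CompleteSpace N := hN.completeSpace_coe
  have hP : ξ - N.starProjection ξ ∈ Nᗮ := N.sub_starProjection_mem_orthogonal ξ
  have hz := key _ ((sectionsSubmodule ν S H).sub_mem hξ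
    (hNH (N.starProjection_apply_mem ξ))) hP
  rw [sub_eq_zero.1 hz]
  exact N.starProjection_apply_mem ξ

end DirectIntegral

/-! ### Products of test functions -/

section Tensor

variable {D : ℕ}

lemma contDiff_tensor {h : ℝ → ℝ} (hh : ContDiff ℝ ∞ h) {ψ : Perp D → ℝ} (hψ : ContDiff ℝ ∞ ψ) :
    ContDiff ℝ ∞ fun y : NPlane D => h y.1 * ψ y.2 :=
  (hh.comp contDiff_fst).mul (hψ.comp contDiff_snd)

lemma tsupport_tensor_subset (h : ℝ → ℝ) (ψ : Perp D → ℝ) :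
    tsupport (fun y : NPlane D => h y.1 * ψ y.2) ⊆ tsupport h ×ˢ tsupport ψ := by
  refine closure_minimal (fun y hy => ?_) ((isClosed_tsupport h).prod (isClosed_tsupport ψ))
  have hy' : h y.1 * ψ y.2 ≠ 0 := hy
  exact ⟨subset_tsupport _ (left_ne_zero_of_mul hy'), subset_tsupport _ (right_ne_zero_of_mul hy')⟩

lemma hasCompactSupport_tensor {h : ℝ → ℝ} (hc : HasCompactSupport h) {ψ : Perp D → ℝ}
    (hψc : HasCompactSupport ψ) : HasCompactSupport fun y : NPlane D => h y.1 * ψ y.2 :=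
  (hc.isCompact.prod hψc.isCompact).of_isClosed_subset (isClosed_tsupport _)
    (tsupport_tensor_subset h ψ)

lemma derivPlus_tensor (h : ℝ → ℝ) (ψ : Perp D → ℝ) :
    derivPlus (fun y : NPlane D => h y.1 * ψ y.2) = fun y => deriv h y.1 * ψ y.2 := by
  funext y
  simp only [derivPlus]
  exact deriv_mul_const_field _

lemma plusTransform_tensor (h : ℝ → ℝ) (ψ : Perp D → ℝ) (z : ℝ × Perp D) :
    plusTransform (fun y : NPlane D => h y.1 * ψ y.2) z =
      fourierLine h (Real.exp (-z.1)) * (ψ z.2 : ℂ) := by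
  simp only [plusTransform, fourierLine, Complex.ofReal_mul, ← mul_assoc]
  exact integral_mul_const _ _

/-- For a product of test functions the thin Fourier transform on the mass shell is itself a product
of square integrable functions of `θ'` and `p_⊥`. -/
lemma memLp_thinFourier_tensor (hD : 1 < D) (m : ℝ) {h : ℝ → ℝ} (hh : ContDiff ℝ ∞ h)
    (hc : HasCompactSupport h) {ψ : Perp D → ℝ} (hψ : ContDiff ℝ ∞ ψ)
    (hψc : HasCompactSupport ψ) :
    MemLp (thinFourier (derivPlus fun y : NPlane D => h y.1 * ψ y.2)) 2
      (massShellMeasure D m) := by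
  have hπ : 2 * Real.pi ≠ 0 := Real.two_pi_pos.ne'
  have hf := contDiff_derivPlus (contDiff_tensor hh hψ)
  have hfc := hasCompactSupport_derivPlus (contDiff_tensor hh hψ)
    (hasCompactSupport_tensor hc hψc)
  rw [← (measurePreserving_shellPoint hD m).map_eq, memLp_map_measure_iff
    (stronglyMeasurable_thinFourier hf.continuous).aestronglyMeasurable
    (measurable_shellPoint m).aemeasurable]
  set χ : Perp D → ℂ := fun y =>
    (((2 * Real.pi) ^ Module.finrank ℝ (Perp D) * ψ ((2 * Real.pi) • y) : ℝ) : ℂ)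
  have hχ : ContDiff ℝ ∞ χ :=
    Complex.ofRealCLM.contDiff.comp (contDiff_const.mul (hψ.comp (contDiff_const_smul _)))
  have hχc : HasCompactSupport χ :=
    HasCompactSupport.comp_left (g := Complex.ofReal) ((hψc.comp_smul hπ).mul_left) rfl
  refine (memLp_congr_ae (Filter.Eventually.of_forall fun z => ?_)).1
    (memLp_two_tensor (memLp_fourierLine_deriv (hh.of_le (by norm_cast)) hc)
      ((𝓕 (hχc.toSchwartzMap hχ)).memLp 2 (volume : Measure (Perp D))))
  simp only [Function.comp_apply]
  rw [show z = (z.1, z.2) from rfl, thinFourier_shellPoint hf.continuous hfc,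
    SchwartzMap.fourier_coe, derivPlus_tensor, Real.fourier_eq, Real.fourier_eq,
    ← integral_const_mul]
  congr 1
  funext y
  rw [plusTransform_tensor]
  simp only [χ, Circle.smul_def, smul_eq_mul, Complex.real_smul,
    HasCompactSupport.toSchwartzMap_toFun]
  push_cast
  ring

/-- A smooth function with integral zero and support in an interval is the derivative of one with
support in the same interval. -/
lemma exists_primitive {g : ℝ → ℝ} (hg : ContDiff ℝ ∞ g) (hc : HasCompactSupport g)
    {J : Set ℝ} (hJ : J.OrdConnected) (hgJ : tsupport g ⊆ J) (h0 : fourierLine g 0 = 0) :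
    ∃ h : ℝ → ℝ, ContDiff ℝ ∞ h ∧ HasCompactSupport h ∧ tsupport h ⊆ J ∧ deriv h = g := by
  rcases (tsupport g).eq_empty_or_nonempty with he | hne
  · rw [tsupport_eq_empty_iff] at he
    exact ⟨0, contDiff_const, HasCompactSupport.zero, by simp, by rw [he]; exact deriv_zero⟩
  have hint : ∫ t, g t = 0 := by
    have : fourierLine g 0 = ((∫ t, g t : ℝ) : ℂ) := by
      rw [← integral_complex_ofReal]
      simp [fourierLine]
    exact_mod_cast this.symm.trans h0
  set a := sInf (tsupport g)
  set b := sSup (tsupport g)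
  have haJ : a ∈ tsupport g := hc.isCompact.sInf_mem hne
  have hbJ : b ∈ tsupport g := hc.isCompact.sSup_mem hne
  have hsub : tsupport g ⊆ Icc a b := fun t ht =>
    ⟨csInf_le hc.isCompact.bddBelow ht, le_csSup hc.isCompact.bddAbove ht⟩
  -- starting at `a - 1` rather than `a` keeps the half-open interval `(a - 1, t]` around the whole
  -- support of `g` once `t > b`
  have hder : ∀ t, HasDerivAt (fun t => ∫ s in (a - 1)..t, g s) (g t) t := fun t =>
    (hg.continuous.integral_hasStrictDerivAt (a - 1) t).hasDerivAt
  have hderiv : deriv (fun t => ∫ s in (a - 1)..t, g s) = g := funext fun t => (hder t).deriv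
  have hsupp : tsupport (fun t => ∫ s in (a - 1)..t, g s) ⊆ Icc a b := by
    refine closure_minimal (fun t ht => ?_) isClosed_Icc
    by_contra hcon
    refine ht ?_
    simp only
    rcases lt_or_ge t a with hta | hta
    · refine (intervalIntegral.integral_congr (g := fun _ => (0 : ℝ)) fun s hs => ?_).trans
        (by simp)
      have hsa : s < a := hs.2.trans_lt (max_lt (by linarith) hta)
      exact image_eq_zero_of_notMem_tsupport fun h => hsa.not_ge (hsub h).1
    · have htb : b < t := not_le.1 fun h => hcon ⟨hta, h⟩
      rw [intervalIntegral.integral_eq_integral_of_support_subset, hint]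
      intro s hs
      have := hsub (subset_tsupport _ hs)
      exact ⟨by linarith [this.1], by linarith [this.2]⟩
  refine ⟨_, contDiff_infty_iff_deriv.2 ⟨fun t => (hder t).differentiableAt, hderiv.symm ▸ hg⟩,
    isCompact_Icc.of_isClosed_subset (isClosed_tsupport _) hsupp,
    hsupp.trans (hJ.out (hgJ haJ) (hgJ hbJ)), hderiv⟩

end Tensor

/-! ### Local subspaces of the null plane as direct integrals -/

section LocalSubspace

variable {D : ℕ}

lemma boundedLocalSubspace_mono (m : ℝ) {R S : Set (NPlane D)} (h : R ⊆ S) :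
    boundedLocalSubspace m R ≤ boundedLocalSubspace m S :=
  Submodule.topologicalClosure_mono (Submodule.span_mono fun _ ⟨g, h1, h2, h3, h4⟩ =>
    ⟨g, h1, h2, h3.trans h, h4⟩)

/-- Test functions have compact support, so the restriction to bounded subregions is immaterial. -/
lemma localSubspace_eq_boundedLocalSubspace (m : ℝ) {R : Set (NPlane D)} (hR : IsOpen R) :
    localSubspace m R = boundedLocalSubspace m R := by
  refine le_antisymm (Submodule.topologicalClosure_minimal _ ?_
    (Submodule.isClosed_topologicalClosure _)) (Submodule.topologicalClosure_mono
      (Submodule.span_le.2 ?_))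
  · exact iSup₂_le fun S hS => boundedLocalSubspace_mono m hS.2.2
  · rintro ξ ⟨g, h1, h2, h3, h4⟩
    obtain ⟨r, hr⟩ := h2.isCompact.isBounded.subset_ball 0
    refine Submodule.mem_iSup_of_mem (R ∩ Metric.ball 0 r) (Submodule.mem_iSup_of_mem
      ⟨hR.inter Metric.isOpen_ball, Metric.isBounded_ball.subset inter_subset_right,
        inter_subset_left⟩ ?_)
    exact subset_closure (Submodule.subset_span ⟨g, h1, h2, subset_inter h3 hr, h4⟩)

/-- The vectors of the `U(1)`-current with test functions `∂h`, where `h` is supported in all the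
fibres over `U` of the region `R` of the null plane. -/
def tubeVectors (R : Set (NPlane D)) (U : Set (Perp D)) : Set HU1 :=
  {k | ∃ h : ℝ → ℝ, ContDiff ℝ ∞ h ∧ HasCompactSupport h ∧ tsupport h ×ˢ U ⊆ R ∧
    k =ᵐ[volume] fun θ => fourierLine (deriv h) (Real.exp (-θ))}

lemma zero_mem_tubeVectors (R : Set (NPlane D)) (U : Set (Perp D)) :
    (0 : HU1) ∈ tubeVectors R U := by
  refine ⟨0, contDiff_const, HasCompactSupport.zero, by simp, ?_⟩
  filter_upwards [Lp.coeFn_zero ℂ 2 (volume : Measure ℝ)] with θ hθ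
  rw [hθ]
  simp [fourierLine]

lemma tubeVectors_subset_currentSubspace {R : Set (NPlane D)} {U : Set (Perp D)} {x : Perp D}
    (hx : x ∈ U) {J : Set ℝ} (hJ : ∀ t, (t, x) ∈ R → t ∈ J) :
    tubeVectors R U ⊆ currentSubspace J := by
  rintro k ⟨h, h1, h2, h3, h4⟩
  have h1' : ContDiff ℝ 1 h := h1.of_le (by norm_cast)
  exact subset_closure (Submodule.subset_span ⟨deriv h, (contDiff_infty_iff_deriv.1 h1).2,
    h2.deriv, tsupport_deriv_subset.trans fun t ht => hJ t (h3 ⟨ht, hx⟩),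
    fourierLine_deriv_zero h1' h2, h4⟩)

/-- Each generating vector of the current subspace of a fibre comes from a test function whose
support lies in all neighbouring fibres. -/
lemma exists_mem_tubeVectors {R : Set (NPlane D)} (hR : IsOpen R)
    {B : Set (Set (Perp D))} (hB : TopologicalSpace.IsTopologicalBasis B) {x : Perp D} {J : Set ℝ}
    (hJ : J.OrdConnected) (hJR : ∀ t ∈ J, (t, x) ∈ R) {g : ℝ → ℝ} (hg : ContDiff ℝ ∞ g)
    (hc : HasCompactSupport g) (hgJ : tsupport g ⊆ J) (h0 : fourierLine g 0 = 0) {k : HU1}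
    (hk : k =ᵐ[volume] fun θ => fourierLine g (Real.exp (-θ))) :
    ∃ U ∈ B, x ∈ U ∧ k ∈ tubeVectors R U := by
  obtain ⟨h, h1, h2, h3, rfl⟩ := exists_primitive hg hc hJ hgJ h0
  obtain ⟨u, v, -, hv, hu, hxv, huv⟩ := generalized_tube_lemma h2.isCompact
    (isCompact_singleton (x := x)) hR (by
      rintro ⟨t, y⟩ ⟨ht, rfl⟩
      exact hJR t (h3 ht))
  obtain ⟨U, hU, hxU, hUv⟩ := hB.exists_subset_of_mem_open (hxv rfl) hv
  exact ⟨U, hU, hxU, h, h1, h2, (prod_mono hu hUv).trans huv, hk⟩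

/-- The inclusion of the local subspace in the direct integral. -/
lemma spatialDecomposition_mem_squareIntegrableSections (hD : 1 < D) {m : ℝ}
    {S : Set (Perp D)} {I : Perp D → Set ℝ} {R : Set (NPlane D)}
    (hRI : ∀ t x, (t, x) ∈ R ↔ x ∈ S ∧ t ∈ I x) {ξ : OneParticle D m}
    (hξ : ξ ∈ boundedLocalSubspace m R) :
    spatialDecomposition hD m ξ ∈
      squareIntegrableSections volume S fun x => currentSubspace (I x) := by
  set M := sectionsSubmodule (volume : Measure (Perp D)) S fun x => currentSubspace (I x)
  have hM : IsClosed (M : Set (Lp HU1 2 (volume : Measure (Perp D)))) :=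
    isClosed_squareIntegrableSections _ _ fun x _ => Submodule.isClosed_topologicalClosure _
  suffices hle : boundedLocalSubspace m R ≤ M.comap
      ((spatialDecomposition hD m).toLinearEquiv.toLinearMap.restrictScalars ℝ) from hle hξ
  refine Submodule.topologicalClosure_minimal _ (Submodule.span_le.2 ?_)
    (hM.preimage (spatialDecomposition hD m).continuous)
  rintro η ⟨g, hg, hc, hgR, hη⟩
  have hf := contDiff_derivPlus hg
  have hfc := hasCompactSupport_derivPlus hg hc
  have hL := memLp_plusTransform_derivPlus hg hc
  have hV := spatialDecomposition_coeFn hD hf.continuous hfc hL hη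
  have hsupp : ∀ x, tsupport (fun t => g (t, x)) ⊆ {t | x ∈ S ∧ t ∈ I x} := fun x t ht =>
    (hRI t x).1 (hgR (tsupport_slice_subset g x ht))
  constructor
  · filter_upwards [hV, ae_memLp_section (ν := volume) hL] with x hx hm hxS
    change spatialDecomposition hD m η x ∈ _
    rw [hx]
    refine Submodule.smul_mem _ _ (subset_closure (Submodule.subset_span
      ⟨fun t => derivPlus g (t, x), contDiff_slice hf x, hasCompactSupport_slice hfc x, ?_, ?_,
        coeFn_sectionL2 hm⟩))
    · exact (tsupport_deriv_subset (f := fun t => g (t, x))).trans fun t ht => (hsupp x ht).2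
    · exact fourierLine_deriv_zero ((contDiff_slice hg x).of_le (by norm_cast))
        (hasCompactSupport_slice hc x)
  · filter_upwards [hV, ae_memLp_section (ν := volume) hL] with x hx hm hxS
    change spatialDecomposition hD m η x = 0
    have h0 : (fun t => g (t, x)) = 0 := by
      rw [← tsupport_eq_empty_iff]
      exact eq_empty_of_forall_notMem fun t ht => hxS (hsupp x ht).1
    have h1 : sectionL2 volume (plusTransform (derivPlus g)) x = 0 := by
      refine Lp.ext ((coeFn_sectionL2 hm).trans (Filter.EventuallyEq.trans ?_
        (Lp.coeFn_zero ℂ 2 (volume : Measure ℝ)).symm))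
      refine Filter.Eventually.of_forall fun θ => ?_
      simp [plusTransform, fourierLine, derivPlus, h0]
    rw [hx, h1, smul_zero]

lemma exists_boundedLocalSubspace_tensor (hD : 1 < D) (m : ℝ) {R : Set (NPlane D)}
    {U : Set (Perp D)} {k : HU1} (hk : k ∈ tubeVectors R U) {ψ : Perp D → ℝ}
    (hψ : ContDiff ℝ ∞ ψ) (hψc : HasCompactSupport ψ) (hψU : tsupport ψ ⊆ U) :
    ∃ ξ ∈ boundedLocalSubspace m R,
      spatialDecomposition hD m ξ =ᵐ[volume] fun x => ψ x • k := by
  obtain ⟨h, h1, h2, h3, h4⟩ := hk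
  have hg := contDiff_tensor h1 hψ
  have hc := hasCompactSupport_tensor h2 hψc
  have hL := memLp_plusTransform_derivPlus hg hc
  have hT := memLp_thinFourier_tensor hD m h1 h2 hψ hψc
  have hV := spatialDecomposition_coeFn hD (contDiff_derivPlus hg).continuous
    (hasCompactSupport_derivPlus hg hc) hL hT.coeFn_toLp
  refine ⟨(transversalConst D)⁻¹ • hT.toLp _, Submodule.smul_mem _ _ (subset_closure
    (Submodule.subset_span ⟨_, hg, hc, (tsupport_tensor_subset h ψ).trans
      ((prod_mono_right hψU).trans h3), hT.coeFn_toLp⟩)), ?_⟩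
  have hlin : spatialDecomposition hD m ((transversalConst D)⁻¹ • hT.toLp _) =
      (transversalConst D)⁻¹ • spatialDecomposition hD m (hT.toLp _) :=
    ((spatialDecomposition hD m).toLinearEquiv.toLinearMap.restrictScalars ℝ).map_smul _ _
  rw [hlin]
  filter_upwards [Lp.coeFn_smul (transversalConst D)⁻¹ (spatialDecomposition hD m (hT.toLp _)),
    hV, ae_memLp_section (ν := volume) hL] with x hx1 hx2 hx3
  rw [hx1, Pi.smul_apply, hx2, inv_smul_smul₀ (transversalConst_pos D).ne']
  refine Lp.ext ((coeFn_sectionL2 hx3).trans ?_)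
  filter_upwards [h4, Lp.coeFn_smul (ψ x) k] with θ hθ1 hθ2
  rw [hθ2, Pi.smul_apply, hθ1, derivPlus_tensor, plusTransform_tensor, Complex.real_smul, mul_comm]

/-- The direct integral decomposition of the local subspace of an open region of the null plane
whose fibres are intervals. -/
theorem isRealDirectIntegral_localSubspace (hD : 1 < D) (m : ℝ) {S : Set (Perp D)}
    (hS : IsOpen S) {I : Perp D → Set ℝ} (hI : ∀ x, (I x).OrdConnected) {R : Set (NPlane D)}
    (hR : IsOpen R) (hRI : ∀ t x, (t, x) ∈ R ↔ x ∈ S ∧ t ∈ I x) :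
    IsRealDirectIntegral volume S (fun x => currentSubspace (I x))
      (spatialDecomposition hD m '' (localSubspace m R : Set (OneParticle D m))) := by
  have : Fact ((2 : ENNReal) ≠ ⊤) := ⟨by norm_num⟩
  rw [localSubspace_eq_boundedLocalSubspace m hR]
  set N : Submodule ℝ (Lp HU1 2 (volume : Measure (Perp D))) := (boundedLocalSubspace m R).map
    ((spatialDecomposition hD m).toLinearEquiv.toLinearMap.restrictScalars ℝ)
  have hNim : spatialDecomposition hD m '' (boundedLocalSubspace m R : Set (OneParticle D m)) =
      (N : Set (Lp HU1 2 (volume : Measure (Perp D)))) := rfl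
  have hne : ∀ U, Nonempty (tubeVectors R U) := fun U => ⟨⟨0, zero_mem_tubeVectors R U⟩⟩
  let B := TopologicalSpace.countableBasis (Perp D)
  have hBc : Countable B := (TopologicalSpace.countable_countableBasis (Perp D)).to_subtype
  have hB : TopologicalSpace.IsTopologicalBasis B := TopologicalSpace.isBasis_countableBasis _
  -- countably many vectors, dense in the tube vectors of each basic open set
  let k : B × ℕ → HU1 := fun i => TopologicalSpace.denseSeq (tubeVectors R i.1) i.2
  have hk : ∀ i : B × ℕ, k i ∈ tubeVectors R i.1 := fun i => Subtype.prop _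
  have hBne : Nonempty (B × ℕ) := by
    obtain ⟨U, hU, -⟩ := hB.exists_subset_of_mem_open (mem_univ (0 : Perp D)) isOpen_univ
    exact ⟨⟨U, hU⟩, 0⟩
  rw [hNim]
  refine isRealDirectIntegral_of_testFunctions hS.measurableSet ?_ ?_
    (fun i : B × ℕ => (i.1 : Set (Perp D))) k (fun i => hB.isOpen i.1.2) ?_ ?_
  · rw [← hNim]
    exact (spatialDecomposition hD m).toHomeomorph.isClosedMap _
      (Submodule.isClosed_topologicalClosure _)
  · rintro _ ⟨ξ, hξ, rfl⟩
    exact spatialDecomposition_mem_squareIntegrableSections hD hRI hξ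
  · intro x hx
    refine le_antisymm (Submodule.topologicalClosure_minimal _ (Submodule.span_le.2 ?_)
      (Submodule.isClosed_topologicalClosure _)) (Submodule.topologicalClosure_minimal _
        (Submodule.span_le.2 ?_) (Submodule.isClosed_topologicalClosure _))
    · rintro ξ ⟨g, h1, h2, h3, h4, h5⟩
      obtain ⟨U, hU, hxU, hξU⟩ := exists_mem_tubeVectors hR hB (hI x)
        (fun t ht => (hRI t x).2 ⟨hx, ht⟩) h1 h2 h3 h4 h5
      have hd := TopologicalSpace.denseRange_denseSeq (tubeVectors R U) ⟨ξ, hξU⟩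
      have hd' := image_closure_subset_closure_image continuous_subtype_val
        (mem_image_of_mem Subtype.val hd)
      refine closure_mono ?_ hd'
      rintro _ ⟨_, ⟨n, rfl⟩, rfl⟩
      refine Submodule.subset_span ⟨(⟨U, hU⟩, n), ?_⟩
      simp [hxU, k]
    · rintro _ ⟨i, rfl⟩
      by_cases hi : x ∈ (i.1 : Set (Perp D))
      · simp only [indicator_of_mem hi]
        exact tubeVectors_subset_currentSubspace hi (fun t ht => ((hRI t x).1 ht).2) (hk i)
      · simp only [indicator_of_notMem hi]
        exact Submodule.zero_mem _
  · intro i ψ hψ hψc hψU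
    obtain ⟨ξ, hξ, hξ'⟩ := exists_boundedLocalSubspace_tensor hD m (hk i) hψ hψc hψU
    exact ⟨_, ⟨ξ, hξ, rfl⟩, hξ'⟩

end LocalSubspace

end

end NullPlane

theorem mainTheorem4 (D : ℕ) (hD : 1 < D) (m : ℝ) (hm : 0 ≤ m) :
    (∀ (Iperp : Set (NullPlane.Perp D)) (C₁ C₂ : NullPlane.Perp D → ℝ),
      IsOpen Iperp → ContinuousOn C₁ Iperp → ContinuousOn C₂ Iperp →
      NullPlane.IsRealDirectIntegral volume Iperp
        (fun x => NullPlane.currentSubspace (Ioo (C₁ x) (C₂ x)))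
        (NullPlane.spatialDecomposition hD m ''
          (NullPlane.localSubspace m {y | y.2 ∈ Iperp ∧ C₁ y.2 < y.1 ∧ y.1 < C₂ y.2} :
            Set (NullPlane.OneParticle D m)))) ∧
    (∀ C : NullPlane.Perp D → ℝ, Continuous C →
      NullPlane.IsRealDirectIntegral volume univ
        (fun x => NullPlane.currentSubspace (Ioi (C x)))
        (NullPlane.spatialDecomposition hD m ''
          (NullPlane.localSubspace m (NullPlane.nullCut C) : Set (NullPlane.OneParticle D m))) ∧
      NullPlane.IsRealDirectIntegral volume univ
        (fun x => NullPlane.currentSubspace (Iio (C x)))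
        (NullPlane.spatialDecomposition hD m ''
          (NullPlane.localSubspace m (NullPlane.nullCutDagger C) :
            Set (NullPlane.OneParticle D m)))) := by
  refine ⟨fun Iperp C₁ C₂ hI h₁ h₂ => ?_, fun C hC => ⟨?_, ?_⟩⟩
  -- `C₁` and `C₂` are continuous on `Iperp` only, hence the pointwise check of openness
  · refine NullPlane.isRealDirectIntegral_localSubspace hD m hI (fun x => ordConnected_Ioo) ?_
      fun t x => Iff.rfl
    have hI' : IsOpen (Prod.snd ⁻¹' Iperp : Set (NullPlane.NPlane D)) := hI.preimage continuous_snd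
    have h₁' : ContinuousOn (fun y : NullPlane.NPlane D => C₁ y.2) (Prod.snd ⁻¹' Iperp) :=
      h₁.comp continuousOn_snd fun y hy => hy
    have h₂' : ContinuousOn (fun y : NullPlane.NPlane D => C₂ y.2) (Prod.snd ⁻¹' Iperp) :=
      h₂.comp continuousOn_snd fun y hy => hy
    rw [isOpen_iff_mem_nhds]
    rintro y ⟨hy, hy1, hy2⟩
    have hn := hI'.mem_nhds (show y ∈ Prod.snd ⁻¹' Iperp from hy)
    filter_upwards [hn, (h₁'.continuousAt hn).eventually_lt continuousAt_fst hy1,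
      continuousAt_fst.eventually_lt (h₂'.continuousAt hn) hy2] with z hz hz1 hz2
    exact ⟨hz, hz1, hz2⟩
  · exact NullPlane.isRealDirectIntegral_localSubspace hD m isOpen_univ
      (fun x => ordConnected_Ioi)
      (isOpen_lt (hC.comp continuous_snd) continuous_fst) fun t x => by
        simp [NullPlane.nullCut]
  · refine NullPlane.isRealDirectIntegral_localSubspace hD m isOpen_univ
      (fun x => ordConnected_Iio) isClosed_closure.isOpen_compl fun t x => ?_
    have hcl : closure (NullPlane.nullCut C) = {y : NullPlane.NPlane D | C y.2 ≤ y.1} := by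
      refine subset_antisymm (closure_minimal (fun y (hy : C y.2 < y.1) => hy.le)
        (isClosed_le (hC.comp continuous_snd) continuous_fst)) fun y hy => ?_
      -- the points `(y₊ + ε, y_⊥)` of the null cut approximate `y`
      have hlim : Filter.Tendsto (fun ε : ℝ => ((y.1 + ε, y.2) : NullPlane.NPlane D))
          (nhdsWithin 0 (Ioi 0)) (nhds y) := by
        have hcont : Continuous fun ε : ℝ => ((y.1 + ε, y.2) : NullPlane.NPlane D) := by fun_prop
        have := (hcont.tendsto 0).mono_left (nhdsWithin_le_nhds (s := Ioi 0))
        simpa using this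
      refine mem_closure_of_tendsto hlim ?_
      filter_upwards [self_mem_nhdsWithin] with ε hε
      have hε' : (0 : ℝ) < ε := hε
      have hy' : C y.2 ≤ y.1 := hy
      change C y.2 < y.1 + ε
      linarith
    simp [NullPlane.nullCutDagger, hcl]
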